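/- **Setting.** Let $\varphi=(\varphi^i)_{i=1,\dots,n}$ be coordinates of Grassmann parity $\varepsilon_i$ on a superdomain, i.e. the even $\varphi^i$ range over an open set $\Omega$ of a real coordinate space and the odd ones are Grassmann generators; functions of $\varphi$ are smooth in the even coordinates. Let $S_0(\varphi)$ be an even function on $\Omega$, let $T_i:=S_0\overleftarrow{\partial}/\partial\varphi^i$ (right derivative), and let $\Sigma\subseteq\Omega$ be the stationary surface, where all $T_i$ vanish (odd coordinates put to zero). For each stage $s\ge 0$ let $\alpha_s\in\{1,\dots,m_s\}$ be an index with parities $\varepsilon_{\alpha_s}$. Introduce supercommuting antifields $\varphi^*_i$ (parity $\varepsilon_i+1$, antifield number $\mathrm{afn}=1$) and $c^*_{\alpha_s}$ (parity $\varepsilon_{\alpha_s}+s$, $\mathrm{afn}=s+2$); $\varphi$ has $\mathrm{afn}=0$. $\Phi^*$ denotes all antifields $\varphi^*,c^*$; write $\Phi^*_{\alpha_{-1}}=\varphi^*_i$. For an integer $k\ge -1$ the $k$-th complex (over an open $U\subseteq\Omega$) is the algebra of functions of $\varphi$ (over $U$), $\varphi^*$ and those $c^*_{\alpha_s}$ with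 $s\le k$, polynomial in the antifields. $\mathcal O((\Phi^*)^n)$ means that every term contains at least $n$ antifields, and $\mathcal O((c^*)^2,(\Phi^*)^3)$ that every term contains at least two $c^*$'s or at least three $\Phi^*$'s. Structure functions are functions of $\varphi$ alone, whose parity is the sum of the parities of their indices. Let structure functions $R^i{}_{\alpha_0}=Z^{\alpha_{-1}}{}_{\alpha_0}$ and $Z^{\alpha_{s-1}}{}_{\alpha_s}$, $s\ge1$, be given. A Koszul–Tate operator $\mathbf s_{-1}$ on the $k$-th complex is a Grassmann-odd left derivation of it of antifield number $-1$, not acting on $\varphi$, with $\mathbf s_{-1}\varphi^*_i=T_i$, $\mathbf s_{-1}c^*_{\alpha_0}=\varphi^*_iR^i{}_{\alpha_0}$ and $\mathbf s_{-1}c^*_{\alpha_s}=c^*_{\alpha_{s-1}}Z^{\alpha_{s-1}}{}_{\alpha_s}+\mathcal O((\Phi^*)^2)$ for $1\le s\le k$. It is nilpotent if $\mathbf s_{-1}^2=0$ on that complex, and acyclic on the $j$-th complex if each $f$ in the $j$-th complex with definite $\mathrm{afn}(f)>0$ and $\mathbf s_{-1}f=0$ equals $\mathbf s_{-1}g$ for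 some $g$ in the $(j+1)$-st complex. **Lemma.** Let $r\ge1$. Let $U\subseteq\Omega$ be an open (for instance tubular) neighbourhood of $\Sigma$, and let $\mathbf s_{-1}$ be a nilpotent Koszul–Tate operator on the $r$-th complex over $U$ that is acyclic on the $(r-2)$-th complex. Suppose that over $U$ an $(r+1)$-stage Noether identity $$Z^{\alpha_{r-1}}{}_{\alpha_r}Z^{\alpha_r}{}_{\alpha_{r+1}}=T_i\,B^{i\alpha_{r-1}}_{\alpha_{r+1}}$$ holds with structure functions $Z^{\alpha_r}{}_{\alpha_{r+1}}$ and $B^{i\alpha_{r-1}}_{\alpha_{r+1}}$. 1. There is a nilpotent Koszul–Tate operator on the $(r+1)$-th complex over $U$ that extends $\mathbf s_{-1}$, with $$\mathbf s_{-1}c^*_{\alpha_{r+1}}=c^*_{\alpha_r}Z^{\alpha_r}{}_{\alpha_{r+1}}+\mathcal O((\Phi^*)^2).$$ 2. Every such extension, over any open $V$ with $\Sigma\subseteq V\subseteq U$ (extending the restriction of $\mathbf s_{-1}$ to $V$), is of the form $$\mathbf s_{-1}c^*_{\alpha_{r+1}}=c^*_{\alpha_r}Z^{\alpha_r}{}_{\alpha_{r+1}}-(-1)^{\varepsilon(c^*_{\alpha_{r-1}})}c^*_{\alpha_{r-1}}\varphi^*_i\Big(B^{i\alpha_{r-1}}_{\alpha_{r+1}}+R^i{}_{\alpha_0}X^{\alpha_0\alpha_{r-1}}_{\alpha_{r+1}}+T_jY^{ji\alpha_{r-1}}_{\alpha_{r+1}}\Big)+\mathcal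 O\big((c^*)^2,(\Phi^*)^3\big)$$ for some structure functions $X^{\alpha_0\alpha_{r-1}}_{\alpha_{r+1}}$ and $Y^{ji\alpha_{r-1}}_{\alpha_{r+1}}=-(-1)^{\varepsilon_i\varepsilon_j}Y^{ij\alpha_{r-1}}_{\alpha_{r+1}}$ over $V$. -/

import Mathlib

open scoped ContDiff Manifold
open TopologicalSpace (Opens)

namespace KoszulTate

noncomputable section

/-- The Grassmann sign `(-1)^e`, for `e` a Grassmann parity. -/
def sgn (e : ZMod 2) : ℤ := if e = 0 then 1 else -1

/-- The index content of a reducible gauge theory. The index `t : ℕ` is the stage plus one: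
`t = 0` is the set of original fields `φ^i`, and `t = s + 1` is the set of stage-`s`
gauge(-for-gauge)^s symmetries. `mult t` is the multiplicity `m_{t-1}` (it is zero above the top
stage) and `par t α` is the Grassmann parity `ε_α` of the index `α = α_{t-1}`. -/
structure FieldContent where
  mult : ℕ → ℕ
  par : (t : ℕ) → Fin (mult t) → ZMod 2

variable (F : FieldContent)

/-- Indices `i` of the Grassmann-even original fields (ordinary real coordinates). -/
abbrev EvenIx := {i : Fin (F.mult 0) // F.par 0 i = 0}

/-- Indices `i` of the Grassmann-odd original fields (Grassmann coordinates `θ`). -/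
abbrev OddIx := {i : Fin (F.mult 0) // ¬ F.par 0 i = 0}

/-- The space of values of the Grassmann-even original fields. -/
abbrev Base := EvenIx F → ℝ

/-- Smooth real functions on an open set of values of the even original fields. -/
abbrev Smooth (U : Opens (Base F)) := C^∞⟮𝓘(ℝ, Base F), U; 𝓘(ℝ, ℝ), ℝ⟯

/-- Restriction of smooth functions to a smaller open set. -/
abbrev Smooth.res {U V : Opens (Base F)} (h : V ≤ U) : Smooth F U →+* Smooth F V :=
  ContMDiffMap.restrictRingHom 𝓘(ℝ, Base F) 𝓘(ℝ, ℝ) ℝ h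

/-- The generators over the smooth functions: the odd original fields `θ_i`, and the antifields
`Φ*_α`, where `af 0 i` is the original antifield `φ*_i` and `af (s+1) α` is the stage-`s` ghost
antifield `c*_α`. -/
inductive Gen
  | theta (i : OddIx F)
  | af (t : ℕ) (α : Fin (F.mult t))

namespace Gen

variable {F}

/-- Grassmann parity: `ε(φ*_i) = ε_i + 1` and `ε(c*_α) = ε_α + s` at stage `s`. -/
def parity : Gen F → ZMod 2
  | theta _ => 1
  | af t α => F.par t α + t + 1

/-- Antifield number: `0` for fields, `1` for `φ*_i`, `s + 2` for `c*_α` at stage `s`. -/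
def afn : Gen F → ℤ
  | theta _ => 0
  | af t _ => t + 1

/-- Is the generator an antifield `Φ*`, that is `φ*` or `c*`? -/
def isAntifield : Gen F → Bool
  | theta _ => false
  | af _ _ => true

/-- Is the generator a ghost antifield `c*` (of stage at least zero)? -/
def isGhostAntifield : Gen F → Bool
  | theta _ => false
  | af 0 _ => false
  | af (_ + 1) _ => true

end Gen

section SuperAlgebra

variable (C : Type) [CommRing C]

/-- Supercommutativity. When `2` is invertible in `C`, as it is below, this includes
`x * x = 0` for every odd generator `x`. -/
inductive SuperComm : FreeAlgebra C (Gen F) → FreeAlgebra C (Gen F) → Prop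
  | comm (x y : Gen F) : SuperComm
      (FreeAlgebra.ι C x * FreeAlgebra.ι C y)
      (sgn (x.parity * y.parity) • (FreeAlgebra.ι C y * FreeAlgebra.ι C x))

/-- The free supercommutative `C`-algebra on the generators `Gen F`. -/
abbrev SAlg := RingQuot (SuperComm F C)

/-- The class of a generator. -/
def gen (x : Gen F) : SAlg F C := RingQuot.mkAlgHom C (SuperComm F C) (FreeAlgebra.ι C x)

variable {F C} in
theorem gen_comm (x y : Gen F) :
    gen F C x * gen F C y = sgn (x.parity * y.parity) • (gen F C y * gen F C x) := by
  simpa [gen] using RingQuot.mkAlgHom_rel C (SuperComm.comm (C := C) x y)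

/-- The monomial given by a list of generators. -/
def word (l : List (Gen F)) : SAlg F C := (l.map (gen F C)).prod

/-- The functions all of whose monomials satisfy `P`. -/
def wordSpan (P : List (Gen F) → Prop) : Submodule C (SAlg F C) :=
  Submodule.span C {x | ∃ l, P l ∧ word F C l = x}

/-- The functions of Grassmann parity `e`. -/
def parityPart (e : ZMod 2) : Submodule C (SAlg F C) :=
  wordSpan F C fun l => (l.map Gen.parity).sum = e

/-- The functions of antifield number `k`. -/
def afnPart (k : ℤ) : Submodule C (SAlg F C) :=
  wordSpan F C fun l => (l.map Gen.afn).sum = k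

/-- The functions of the original fields `φ` alone. -/
def phiPart : Submodule C (SAlg F C) :=
  wordSpan F C fun l => l.countP Gen.isAntifield = 0

/-- `𝒪((Φ*)^n)`: every term has at least `n` antifields. -/
def orderAf (n : ℕ) : Submodule C (SAlg F C) :=
  wordSpan F C fun l => n ≤ l.countP Gen.isAntifield

/-- `𝒪((c*)^2, (Φ*)^3)`: every term has at least two ghost antifields `c*` or at least three
antifields `Φ*`. -/
def orderMixed : Submodule C (SAlg F C) :=
  wordSpan F C fun l => 2 ≤ l.countP Gen.isGhostAntifield ∨ 3 ≤ l.countP Gen.isAntifield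

/-- The `k`th complex: the functions of `φ`, `φ*` and the `c*` of stage at most `k`. It makes
sense for every integer `k`; the `(-1)`st complex consists of the functions of `φ` and `φ*`. -/
def cpx (k : ℤ) : Subalgebra C (SAlg F C) :=
  Algebra.adjoin C
    ({x | ∃ i, x = gen F C (.theta i)} ∪
      {x | ∃ (t : ℕ) (α : Fin (F.mult t)), (t : ℤ) - 1 ≤ k ∧ x = gen F C (.af t α)})

variable {F C} in
/-- An odd original field, as an element of the `k`th complex. -/
def thetaIn (k : ℤ) (i : OddIx F) : cpx F C k :=
  ⟨gen F C (.theta i), Algebra.subset_adjoin (Or.inl ⟨i, rfl⟩)⟩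

variable {F C} in
/-- An antifield of stage at most `k`, as an element of the `k`th complex. -/
def afIn {k : ℤ} {t : ℕ} (h : (t : ℤ) - 1 ≤ k) (α : Fin (F.mult t)) : cpx F C k :=
  ⟨gen F C (.af t α), Algebra.subset_adjoin (Or.inr ⟨t, α, h, rfl⟩)⟩

variable {C} in
/-- Change of coefficient ring; the generators are mapped to themselves. -/
def SAlg.map {D : Type} [CommRing D] (f : C →+* D) : SAlg F C →+* SAlg F D :=
  letI : Algebra C (SAlg F D) :=
    ((algebraMap D (SAlg F D)).comp f).toAlgebra' fun c x => Algebra.commutes (f c) x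
  (RingQuot.liftAlgHom C (s := SuperComm F C)
    ⟨FreeAlgebra.lift C (gen F D), by
      rintro _ _ ⟨x, y⟩
      simpa using gen_comm x y⟩ : SAlg F C →ₐ[C] SAlg F D).toRingHom

end SuperAlgebra

variable {F}

/-- The algebra of functions `f(φ; φ*, c*)` over an open set `U` of values of the even original
fields: smooth in these, polynomial in all the other variables. -/
abbrev Alg (U : Opens (Base F)) := SAlg F (Smooth F U)

/-- Restriction of functions to a smaller open set. -/
def Alg.res {U V : Opens (Base F)} (h : V ≤ U) : Alg U →+* Alg V :=
  SAlg.map F (Smooth.res F h)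

/-- A function of the original fields `φ`, given by its coefficients `f_J` in the expansion
`f(x, θ) = ∑_J f_J(x) θ_J`, where `θ_J` is the product of the `θ_j`, `j ∈ J`, in increasing
order. -/
abbrev SuperFn (Ω : Opens (Base F)) := Finset (OddIx F) → Smooth F Ω

namespace SuperFn

variable {Ω : Opens (Base F)}

/-- A function of `φ` on `Ω`, as an element of the algebra over the smaller open set `U`. -/
def toAlg {U : Opens (Base F)} (h : U ≤ Ω) (f : SuperFn Ω) : Alg U :=
  ∑ J : Finset (OddIx F),
    Smooth.res F h (f J) • word F (Smooth F U) ((J.sort (· ≤ ·)).map Gen.theta)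

/-- The partial derivative of a smooth function along a coordinate. -/
def coordDeriv (i : EvenIx F) (f : Smooth F Ω) : Smooth F Ω :=
  ⟨fun x => fderiv ℝ (Function.extend ((↑) : Ω → Base F) f 0) x (Pi.single i 1), by
    intro x
    have hf : ContMDiffAt 𝓘(ℝ, Base F) 𝓘(ℝ, ℝ) ∞
        (fun y : Ω => Function.extend ((↑) : Ω → Base F) f 0 (y : Base F)) x := by
      have : (fun y : Ω => Function.extend ((↑) : Ω → Base F) f 0 (y : Base F)) = f := by
        funext y
        exact Subtype.val_injective.extend_apply f 0 y
      rw [this]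
      exact f.contMDiff x
    rw [contMDiffAt_subtype_iff, contMDiffAt_iff_contDiffAt] at hf
    have hd : ContDiffAt ℝ ∞
        (fun y => fderiv ℝ (Function.extend ((↑) : Ω → Base F) f 0) y (Pi.single i 1))
        (x : Base F) :=
      (hf.fderiv_right (m := ∞) (by simp)).clm_apply contDiffAt_const
    exact contMDiffAt_subtype_iff.mpr (contMDiffAt_iff_contDiffAt.mpr hd)⟩

/-- The right partial derivative `f ∂/∂φ^i`: coefficientwise for an even field `φ^i`, and
`(f_{J ∪ i} θ_{J ∪ i}) ∂/∂θ_i = (-1)^{#{j ∈ J : i < j}} f_{J ∪ i} θ_J` for an odd one. -/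
def rightDeriv (i : Fin (F.mult 0)) (f : SuperFn Ω) : SuperFn Ω := fun J =>
  if h : F.par 0 i = 0 then coordDeriv ⟨i, h⟩ (f J)
  else if ⟨i, h⟩ ∈ J then 0
  else (-1) ^ (J.filter fun j => i < j.1).card * f (insert ⟨i, h⟩ J)

/-- A Grassmann-even function of `φ`. -/
def IsEven (f : SuperFn Ω) : Prop := ∀ J, Odd J.card → f J = 0

/-- The stationary surface of the original action `S₀`: the points of its domain where all
the field equations `T_i = S₀ ∂/∂φ^i` vanish (when the odd variables are put to zero). -/
def stationarySurface (S₀ : SuperFn Ω) : Set (Base F) :=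
  {x | ∃ hx : x ∈ Ω, ∀ i, S₀.rightDeriv i ∅ ⟨x, hx⟩ = 0}

/-- The field equations `T_i = S₀ ∂/∂φ^i` over `U`. -/
def eom {U : Opens (Base F)} (S₀ : SuperFn Ω) (h : U ≤ Ω) (i : Fin (F.mult 0)) : Alg U :=
  (S₀.rightDeriv i).toAlg h

end SuperFn

/-- The antifield `Φ*_α`; `Φs U 0 i` is `φ*_i`, `Φs U (s+1) α` is the stage-`s` antifield `c*_α`. -/
abbrev Φs (U : Opens (Base F)) (t : ℕ) (α : Fin (F.mult t)) : Alg U :=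
  gen F (Smooth F U) (.af t α)

/-- A structure function of parity `e`: it depends on `φ` only. -/
def IsStructureFn {U : Opens (Base F)} (e : ZMod 2) (f : Alg U) : Prop :=
  f ∈ phiPart F (Smooth F U) ∧ f ∈ parityPart F (Smooth F U) e

/-- Families of gauge(-for-gauge) generators: `Z t α β` is `Z^α_β` with `α` of stage `t - 1` and
`β` of stage `t`. In particular `Z 0 i α` is the gauge generator `R^i_α`. -/
abbrev Generators (U : Opens (Base F)) :=
  (t : ℕ) → Fin (F.mult t) → Fin (F.mult (t + 1)) → Alg U

section Operators

variable {Ω U V : Opens (Base F)}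

/-- Linear operators on the `k`th complex over `U`. Linearity over smooth functions of the even
`φ^i` expresses that the operators considered do not act on them. -/
abbrev Op (U : Opens (Base F)) (k : ℤ) :=
  cpx F (Smooth F U) k →ₗ[Smooth F U] cpx F (Smooth F U) k

/-- `s` is a Koszul-Tate operator on the `k`th complex, for the action `S₀` and the generators
`Z`: a Grassmann-odd left derivation `V_α ∂/∂Φ*_α` of antifield number `-1`, which does
not act on the original fields, with `V_i = T_i`, `V_{α_0} = φ*_i R^i_{α_0}` and
`V_{α_s} = c*_{α_{s-1}} Z^{α_{s-1}}_{α_s} + 𝒪((Φ*)^2)` for `1 ≤ s ≤ k`. -/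
structure IsKoszulTate (S₀ : SuperFn Ω) (h : U ≤ Ω) (Z : Generators U) (k : ℤ) (s : Op U k) :
    Prop where
  leibniz : ∀ (e : ZMod 2) (a b : cpx F (Smooth F U) k),
    (a : Alg U) ∈ parityPart F (Smooth F U) e → s (a * b) = s a * b + sgn e • (a * s b)
  odd : ∀ (e : ZMod 2) (a : cpx F (Smooth F U) k),
    (a : Alg U) ∈ parityPart F (Smooth F U) e → (s a : Alg U) ∈ parityPart F (Smooth F U) (e + 1)
  afn : ∀ (j : ℤ) (a : cpx F (Smooth F U) k),
    (a : Alg U) ∈ afnPart F (Smooth F U) j → (s a : Alg U) ∈ afnPart F (Smooth F U) (j - 1)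
  theta : ∀ i : OddIx F, s (thetaIn k i) = 0
  original : ∀ (hk : ((0 : ℕ) : ℤ) - 1 ≤ k) (i : Fin (F.mult 0)),
    (s (afIn hk i) : Alg U) = S₀.eom h i
  stageZero : ∀ (hk : ((1 : ℕ) : ℤ) - 1 ≤ k) (α : Fin (F.mult 1)),
    (s (afIn hk α) : Alg U) = ∑ i, Φs U 0 i * Z 0 i α
  higherStage : ∀ (t : ℕ) (hk : ((t + 1 : ℕ) : ℤ) - 1 ≤ k) (α : Fin (F.mult (t + 1))), 1 ≤ t →
    (s (afIn hk α) : Alg U) - ∑ β, Φs U t β * Z t β α ∈ orderAf F (Smooth F U) 2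

/-- Nilpotency `s² = 0` on the complex where `s` is defined. -/
def IsNilpotentOp {k : ℤ} (s : Op U k) : Prop := ∀ a, s (s a) = 0

/-- `s`, an operator on the `k`th complex, is acyclic on the `j`th complex: every closed function
of the `j`th complex of strictly positive antifield number is `s g` for some `g` in the next, the
`(j+1)`st, complex (whose new antifields are there to kill the cycles of the `j`th one). -/
def IsAcyclicOn {k : ℤ} (s : Op U k) (j : ℤ) : Prop :=
  ∀ (p : ℤ) (f : cpx F (Smooth F U) k), 0 < p → (f : Alg U) ∈ afnPart F (Smooth F U) p →
    (f : Alg U) ∈ cpx F (Smooth F U) j → s f = 0 →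
    ∃ g : cpx F (Smooth F U) k, (g : Alg U) ∈ cpx F (Smooth F U) (j + 1) ∧ s g = f

/-- Over `V ⊆ U`, the operator `s'` on the `l`th complex extends the operator `s` on the `k`th
complex. -/
def Extends (hV : V ≤ U) {k l : ℤ} (s : Op U k) (s' : Op V l) : Prop :=
  ∀ (a : cpx F (Smooth F U) k) (b : cpx F (Smooth F V) l),
    (b : Alg V) = Alg.res hV a → (s' b : Alg V) = Alg.res hV (s a)

end Operators

end

end KoszulTate

namespace KoszulTate

/-! ### Signs -/

/-! Existence is a perturbation argument. Write `D` for the given operator. Its value `n` on a new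
antifield must be `D`-closed, of antifield number `r + 2`, and begin with `c*_{α_r} Z`. Applying `D`
to this leading term gives `c*_{α_{r-1}} Z Z` plus terms quadratic in the antifields. The Noether
identity turns `Z Z` into `T B`, and subtracting `± c*_{α_{r-1}} φ*_i B^i` cancels it, since `D φ*_i
= T_i`. For the resulting `p`, counting antifield numbers shows that `D p` involves only stages up
to `r - 2`. There it is a cycle of positive antifield number, so `D p = D g` with `g` of stage at
most `r - 1`. Such a `g`, of antifield number `r + 2`, contains at least two antifields in every
term, so `n = p - g` keeps the leading term (`IsKoszulTate.exists_approx`,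
`IsKoszulTate.exists_closed`). Nilpotency of a derivation need only be checked on generators, which
gives the extension (`IsKoszulTate.exists_extension`).

For the general form, the quadratic part of any extension is, modulo `𝒪((c*)^2, (Φ*)^3)`, a sum of
`c*_{α_{r-1}} φ*_i N^i`. The part of `s² = 0` linear in the antifields says that `∓N - B` is
annihilated by contraction with `T`. Acyclicity at antifield number one writes every such relation
as `R X + T Y` with `Y` graded antisymmetric (`koszulExact_of_acyclic`,
`IsKoszulTate.exists_normalForm`).

Acyclicity is known over `U`, while the extension may live on a smaller `V`. A cutoff `χ`, equal to
one near `Σ` and supported in `V`, bridges this (`KoszulExact.res`). Relations multiplied by `χ`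
extend by zero to `U`; where `1 - χ` is nonzero the `T_i` generate the unit ideal, since their
bodies have no common zero and functions without body are nilpotent, so there all relations are
trivial.

The algebra is handled through words in the generators. Words are not a basis, so independence comes
from projections onto multidegrees. Superderivations are built as homomorphisms into triangular
matrices. -/

theorem sgn_add (a b : ZMod 2) : sgn (a + b) = sgn a * sgn b := by
  revert a b; decide

theorem sgn_mul_self (a : ZMod 2) : sgn a * sgn a = 1 := by
  revert a; decide

@[simp] theorem sgn_zero : sgn 0 = 1 := rfl

variable {F : FieldContent}

section SuperAlgebra

variable {C : Type} [CommRing C]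

/-! ### The free supercommutative algebra -/

section Lift

variable {R : Type*} [Ring R] [Algebra C R] (v : Gen F → R)
  (hv : ∀ x y, v x * v y = sgn (x.parity * y.parity) • (v y * v x))

/-- The universal property of the free supercommutative algebra. -/
noncomputable def SAlg.lift : SAlg F C →ₐ[C] R :=
  RingQuot.liftAlgHom C (s := SuperComm F C)
    ⟨FreeAlgebra.lift C v, by
      rintro _ _ ⟨x, y⟩
      simpa using hv x y⟩

@[simp] theorem SAlg.lift_gen (x : Gen F) : SAlg.lift (C := C) v hv (gen F C x) = v x := by
  simp [SAlg.lift, gen]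

end Lift

theorem SAlg.algHom_ext {R : Type*} [Semiring R] [Algebra C R] {f g : SAlg F C →ₐ[C] R}
    (h : ∀ x, f (gen F C x) = g (gen F C x)) : f = g := by
  apply RingQuot.ringQuot_ext'
  ext x
  exact h x

@[simp] theorem word_nil : word F C [] = 1 := rfl

@[simp] theorem word_cons (x : Gen F) (l : List (Gen F)) :
    word F C (x :: l) = gen F C x * word F C l := by simp [word]

theorem word_append (l l' : List (Gen F)) :
    word F C (l ++ l') = word F C l * word F C l' := by simp [word]

theorem word_singleton (x : Gen F) : word F C [x] = gen F C x := by simp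

theorem word_mem_wordSpan {P : List (Gen F) → Prop} {l : List (Gen F)} (h : P l) :
    word F C l ∈ wordSpan F C P := Submodule.subset_span ⟨l, h, rfl⟩

theorem wordSpan_le {P : List (Gen F) → Prop} {S : Submodule C (SAlg F C)} :
    wordSpan F C P ≤ S ↔ ∀ l, P l → word F C l ∈ S := by
  rw [wordSpan, Submodule.span_le]
  constructor
  · intro h l hl
    exact h ⟨l, hl, rfl⟩
  · rintro h _ ⟨l, hl, rfl⟩
    exact h l hl

theorem wordSpan_mono {P Q : List (Gen F) → Prop} (h : ∀ l, P l → Q l) :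
    wordSpan F C P ≤ wordSpan F C Q :=
  wordSpan_le.2 fun l hl => word_mem_wordSpan (h l hl)

theorem mul_mem_wordSpan {P Q R : List (Gen F) → Prop} (h : ∀ l l', P l → Q l' → R (l ++ l'))
    {a b : SAlg F C} (ha : a ∈ wordSpan F C P) (hb : b ∈ wordSpan F C Q) :
    a * b ∈ wordSpan F C R := by
  have h1 : ∀ l, P l → word F C l * b ∈ wordSpan F C R := fun l hl => by
    have : wordSpan F C Q ≤ (wordSpan F C R).comap (LinearMap.mulLeft C (word F C l)) :=
      wordSpan_le.2 fun l' hl' => by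
        simpa [word_append] using word_mem_wordSpan (C := C) (h l l' hl hl')
    exact this hb
  have : wordSpan F C P ≤ (wordSpan F C R).comap (LinearMap.mulRight C b) :=
    wordSpan_le.2 fun l hl => h1 l hl
  exact this ha

/-- Mapping the generators into the subalgebra `S` and including back fixes every generator, so by
the universal property it is the identity and `S` is everything. -/
theorem wordSpan_true : wordSpan F C (fun _ => True) = ⊤ := by
  let S : Subalgebra C (SAlg F C) := (wordSpan F C fun _ => True).toSubalgebra
    (word_mem_wordSpan (l := []) trivial)
    (fun a b ha hb => mul_mem_wordSpan (fun _ _ _ _ => trivial) ha hb)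
  have hS : ∀ x, gen F C x ∈ S := fun x => by
    rw [← word_singleton]
    exact word_mem_wordSpan (C := C) (P := fun _ => True) trivial
  let f : SAlg F C →ₐ[C] S := SAlg.lift (C := C) (R := S) (fun x => ⟨gen F C x, hS x⟩)
    (fun x y => Subtype.ext (by simpa using gen_comm x y))
  have hf : S.val.comp f = AlgHom.id C _ := SAlg.algHom_ext fun x => by simp [f]
  refine eq_top_iff.2 fun a _ => ?_
  have := (f a).2
  rwa [show ((f a : S) : SAlg F C) = a from DFunLike.congr_fun hf a] at this

theorem mem_wordSpan_true (a : SAlg F C) : a ∈ wordSpan F C (fun _ => True) := by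
  rw [wordSpan_true]; trivial

theorem SAlg.linearMap_ext {M : Type*} [AddCommMonoid M] [Module C M] {f g : SAlg F C →ₗ[C] M}
    (h : ∀ l, f (word F C l) = g (word F C l)) : f = g := by
  apply LinearMap.ext_on (s := {x | ∃ l, True ∧ word F C l = x})
  · exact wordSpan_true
  · rintro _ ⟨l, -, rfl⟩
    exact h l

/-- The monomials are determined by their generators up to a sign. -/
theorem word_perm {l l' : List (Gen F)} (h : l.Perm l') :
    ∃ n : ℤ, n * n = 1 ∧ word F C l = n • word F C l' := by
  induction h with
  | nil => exact ⟨1, by simp⟩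
  | cons x _ ih =>
    obtain ⟨n, hn, h⟩ := ih
    exact ⟨n, hn, by rw [word_cons, word_cons, h, mul_smul_comm]⟩
  | swap x y l =>
    refine ⟨sgn (y.parity * x.parity), sgn_mul_self _, ?_⟩
    simp only [word_cons, ← mul_assoc]
    rw [gen_comm y x, smul_mul_assoc]
  | trans _ _ ih ih' =>
    obtain ⟨n, hn, h⟩ := ih
    obtain ⟨n', hn', h'⟩ := ih'
    exact ⟨n * n', by linear_combination (n' * n') * hn + hn', by rw [h, h', mul_smul]⟩

/-! ### Projections onto sets of monomials -/

/-- A property of monomials that does not depend on the order of the generators. -/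
def PermInvariant (P : List (Gen F) → Prop) : Prop := ∀ l l', l.Perm l' → P l → P l'

theorem permInvariant_sum {M : Type*} [AddCommMonoid M] (f : Gen F → M) (Q : M → Prop) :
    PermInvariant fun l => Q (l.map f).sum := fun l l' h hl => by
  simpa only [← (h.map f).sum_eq] using hl

theorem permInvariant_countP (p : Gen F → Bool) (Q : ℕ → Prop) :
    PermInvariant fun l => Q (l.countP p) := fun l l' h hl => by
  simpa only [← h.countP_eq] using hl

variable (F C) in
/-- The decomposition of a function into parts with given generators. -/
noncomputable def multigrading : SAlg F C →ₐ[C] AddMonoidAlgebra (SAlg F C) (Multiset (Gen F)) :=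
  SAlg.lift (C := C) (R := AddMonoidAlgebra (SAlg F C) (Multiset (Gen F)))
      (fun x => AddMonoidAlgebra.single {x} (gen F C x)) fun x y => by
    -- Both sides of the supercommutation relation have the same multidegree `{x} + {y}`.
    rw [AddMonoidAlgebra.single_mul_single, AddMonoidAlgebra.single_mul_single, gen_comm x y,
      add_comm, AddMonoidAlgebra.smul_single]

theorem multigrading_word (l : List (Gen F)) :
    multigrading F C (word F C l) = AddMonoidAlgebra.single (l : Multiset (Gen F)) (word F C l) := by
  induction l with
  | nil => simp [AddMonoidAlgebra.one_def]
  | cons x l ih =>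
    rw [word_cons, map_mul, ih, multigrading, SAlg.lift_gen, AddMonoidAlgebra.single_mul_single]
    congr 1

open Classical in
/-- The projection onto the part all of whose monomials satisfy `P`. -/
noncomputable def proj (P : List (Gen F) → Prop) : SAlg F C →ₗ[C] SAlg F C :=
  (Finsupp.lsum C fun m : Multiset (Gen F) =>
      if (∃ l : List (Gen F), (l : Multiset (Gen F)) = m ∧ P l) then LinearMap.id else 0) ∘ₗ
    (AddMonoidAlgebra.coeffLinearEquiv C).toLinearMap ∘ₗ (multigrading F C).toLinearMap

-- A word sits in a single multidegree, so the projection keeps or kills it as a whole. Invariance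
-- under permutations is needed because a multidegree remembers the letters but not their order.
open Classical in
theorem proj_word {P : List (Gen F) → Prop} (hP : PermInvariant P) (l : List (Gen F)) :
    proj (C := C) P (word F C l) = if P l then word F C l else 0 := by
  have h : (∃ l' : List (Gen F), (l' : Multiset (Gen F)) = l ∧ P l') ↔ P l :=
    ⟨fun ⟨l', h, h'⟩ => hP l' l (Multiset.coe_eq_coe.1 h) h', fun h => ⟨l, rfl, h⟩⟩
  simp only [proj, LinearMap.comp_apply, AlgHom.toLinearMap_apply, multigrading_word]
  by_cases hl : P l
  · simp [if_pos (h.2 hl), hl, -Multiset.coe_eq_coe]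
  · simp [if_neg (mt h.1 hl), hl, -Multiset.coe_eq_coe]

theorem proj_eq_self {P : List (Gen F) → Prop} (hP : PermInvariant P) {a : SAlg F C}
    (ha : a ∈ wordSpan F C P) : proj P a = a := by
  have : wordSpan F C P ≤ LinearMap.eqLocus (proj P) LinearMap.id :=
    wordSpan_le.2 fun l hl => by simp [LinearMap.mem_eqLocus, proj_word hP, hl]
  exact this ha

theorem proj_eq_zero {P Q : List (Gen F) → Prop} (hP : PermInvariant P) (h : ∀ l, Q l → ¬ P l)
    {a : SAlg F C} (ha : a ∈ wordSpan F C Q) : proj P a = 0 := by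
  have : wordSpan F C Q ≤ LinearMap.ker (proj P) :=
    wordSpan_le.2 fun l hl => by simp [proj_word hP, h l hl]
  exact this ha

theorem proj_mem {P Q : List (Gen F) → Prop} (hP : PermInvariant P)
    {a : SAlg F C} (ha : a ∈ wordSpan F C Q) : proj P a ∈ wordSpan F C fun l => Q l ∧ P l := by
  have : wordSpan F C Q ≤ (wordSpan F C fun l => Q l ∧ P l).comap (proj P) :=
    wordSpan_le.2 fun l hl => by
      rw [Submodule.mem_comap, proj_word hP]
      split_ifs with h
      · exact word_mem_wordSpan ⟨hl, h⟩
      · exact Submodule.zero_mem _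
  exact this ha

theorem sub_proj_mem {P : List (Gen F) → Prop} (hP : PermInvariant P)
    (a : SAlg F C) : a - proj P a ∈ wordSpan F C fun l => ¬ P l := by
  have : wordSpan F C (fun _ => True) ≤
      (wordSpan F C fun l => ¬ P l).comap (LinearMap.id - proj P) :=
    wordSpan_le.2 fun l _ => by
      rw [Submodule.mem_comap, LinearMap.sub_apply, proj_word hP]
      split_ifs with h
      · simp
      · simpa using word_mem_wordSpan (C := C) (P := fun l => ¬ P l) h
  exact this (mem_wordSpan_true a)

theorem mem_wordSpan_and {P Q : List (Gen F) → Prop} (hQ : PermInvariant Q)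
    {a : SAlg F C} (hPa : a ∈ wordSpan F C P) (hQa : a ∈ wordSpan F C Q) :
    a ∈ wordSpan F C fun l => P l ∧ Q l := by
  simpa [proj_eq_self hQ hQa] using proj_mem hQ hPa

/-- This replaces comparison of coefficients in a basis: incompatible order-independent conditions
on words cut out submodules that meet only in zero. -/
theorem eq_zero_of_mem_wordSpan {P Q : List (Gen F) → Prop} (hQ : PermInvariant Q)
    (h : ∀ l, P l → ¬ Q l)
    {a : SAlg F C} (hPa : a ∈ wordSpan F C P) (hQa : a ∈ wordSpan F C Q) : a = 0 := by
  rw [← proj_eq_self hQ hQa, proj_eq_zero hQ h hPa]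

/-! ### Supercommutativity -/

theorem gen_mem_parityPart (x : Gen F) : gen F C x ∈ parityPart F C x.parity := by
  rw [← word_singleton]
  exact word_mem_wordSpan (by simp)

theorem one_mem_parityPart : (1 : SAlg F C) ∈ parityPart F C 0 :=
  word_mem_wordSpan (l := []) (by simp)

theorem mul_mem_parityPart {a b : SAlg F C} {e e' : ZMod 2} (ha : a ∈ parityPart F C e)
    (hb : b ∈ parityPart F C e') : a * b ∈ parityPart F C (e + e') :=
  mul_mem_wordSpan (by rintro l l' rfl rfl; simp) ha hb

theorem mul_mem_phiPart {a b : SAlg F C} (ha : a ∈ phiPart F C)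
    (hb : b ∈ phiPart F C) : a * b ∈ phiPart F C :=
  mul_mem_wordSpan (fun l l' h h' => by rw [List.countP_append, h, h']) ha hb

theorem gen_mul_word (x : Gen F) (l : List (Gen F)) :
    gen F C x * word F C l = sgn (x.parity * (l.map Gen.parity).sum) • (word F C l * gen F C x) := by
  induction l with
  | nil => simp
  | cons y l ih =>
    rw [word_cons, ← mul_assoc, gen_comm, smul_mul_assoc, mul_assoc, ih, mul_smul_comm, smul_smul,
      List.map_cons, List.sum_cons, mul_add, sgn_add, mul_assoc]

theorem word_mul_word (l l' : List (Gen F)) :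
    word F C l * word F C l' = sgn ((l.map Gen.parity).sum * (l'.map Gen.parity).sum) •
      (word F C l' * word F C l) := by
  induction l with
  | nil => simp
  | cons y l ih =>
    rw [word_cons, mul_assoc, ih, mul_smul_comm, ← mul_assoc, gen_mul_word, smul_mul_assoc,
      smul_smul, List.map_cons, List.sum_cons, add_mul, add_comm, sgn_add, mul_assoc]

/-- Homogeneous elements supercommute. -/
theorem mul_comm_of_mem_parityPart {a b : SAlg F C} {e e' : ZMod 2} (ha : a ∈ parityPart F C e)
    (hb : b ∈ parityPart F C e') : a * b = sgn (e * e') • (b * a) := by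
  have h1 : ∀ l : List (Gen F), (l.map Gen.parity).sum = e →
      word F C l * b = sgn (e * e') • (b * word F C l) := fun l hl => by
    have : parityPart F C e' ≤ LinearMap.eqLocus (LinearMap.mulLeft C (word F C l))
        (sgn (e * e') • LinearMap.mulRight C (word F C l)) :=
      wordSpan_le.2 fun l' hl' => by
        subst hl hl'
        exact word_mul_word l l'
    exact this hb
  have : parityPart F C e ≤ LinearMap.eqLocus (LinearMap.mulRight C b)
      (sgn (e * e') • LinearMap.mulLeft C b) :=
    wordSpan_le.2 fun l hl => h1 l hl
  exact this ha

theorem zsmul_mem_wordSpan {P : List (Gen F) → Prop} (n : ℤ) {a : SAlg F C}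
    (ha : a ∈ wordSpan F C P) : n • a ∈ wordSpan F C P :=
  zsmul_mem ha n

/-! ### Superderivations -/

/-- Multiplication by the sign `(-1)^(p ε)`. -/
noncomputable def twist (p : ZMod 2) : SAlg F C →ₐ[C] SAlg F C :=
  SAlg.lift (fun x => sgn (p * x.parity) • gen F C x) fun x y => by
    simp only [smul_mul_assoc, mul_smul_comm, smul_smul]
    rw [gen_comm x y, smul_smul]
    congr 1
    ring

theorem twist_word (p : ZMod 2) (l : List (Gen F)) :
    twist p (word F C l) = sgn (p * (l.map Gen.parity).sum) • word F C l := by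
  induction l with
  | nil => simp
  | cons x l ih =>
    rw [word_cons, map_mul, ih, twist, SAlg.lift_gen, List.map_cons, List.sum_cons, mul_add,
      sgn_add, smul_mul_assoc, mul_smul_comm, smul_smul]

theorem twist_of_mem {p e : ZMod 2} {a : SAlg F C} (ha : a ∈ parityPart F C e) :
    twist p a = sgn (p * e) • a := by
  have : parityPart F C e ≤ LinearMap.eqLocus (twist p).toLinearMap
      (sgn (p * e) • LinearMap.id) :=
    wordSpan_le.2 fun l hl => by
      subst hl
      exact twist_word p l
  exact this ha

section Derivation

variable (p : ZMod 2) (v : Gen F → SAlg F C)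
  (hv : ∀ x, v x ∈ parityPart F C (x.parity + p))

/-- The homomorphism to triangular matrices that encodes a superderivation. -/
noncomputable def superDerMatrix : SAlg F C →ₐ[C] Matrix (Fin 2) (Fin 2) (SAlg F C) :=
  -- In a product of such matrices the upper right entry is `D a * b + twist a * D b`, the graded
  -- Leibniz rule. The parity condition on `v` makes the matrices satisfy the defining relations.
  SAlg.lift (fun x => !![twist p (gen F C x), v x; 0, gen F C x]) fun x y => by
    have hx := mul_comm_of_mem_parityPart (hv x) (gen_mem_parityPart y)
    have hy := mul_comm_of_mem_parityPart (hv y) (gen_mem_parityPart x)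
    ext i j
    rw [Matrix.smul_apply]
    fin_cases i <;> fin_cases j <;>
      simp [Matrix.mul_apply, Fin.sum_univ_two, -zsmul_eq_mul]
    · rw [← map_mul, gen_comm, map_zsmul, map_mul]
    · rw [hx, twist_of_mem (gen_mem_parityPart x), twist_of_mem (gen_mem_parityPart y),
        smul_mul_assoc, smul_mul_assoc, hy, zsmul_add, smul_smul, smul_smul, add_comm]
      congr 2
      · generalize x.parity = a
        generalize y.parity = b
        clear hx hy hv
        revert a b p; decide
      · generalize x.parity = a
        generalize y.parity = b
        clear hx hy hv
        revert a b p; decide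
    · simp
    · exact gen_comm x y

/-- The left superderivation of parity `p` with given values on the generators. -/
noncomputable def superDer : SAlg F C →ₗ[C] SAlg F C where
  toFun a := superDerMatrix p v hv a 0 1
  map_add' a b := by simp
  map_smul' c a := by simp

/-- The upper right entry is `superDer` by definition. The other three entries are multiplicative by
themselves, so induction on words settles them without knowing that one. -/
theorem superDerMatrix_apply (a : SAlg F C) :
    superDerMatrix p v hv a = !![twist p a, superDer p v hv a; 0, a] := by
  let f : SAlg F C →ₗ[C] Matrix (Fin 2) (Fin 2) (SAlg F C) :=
    { toFun := fun a => !![twist p a, superDer p v hv a; 0, a]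
      map_add' := fun a b => by simp
      map_smul' := fun c a => by simp }
  suffices h : (superDerMatrix p v hv).toLinearMap = f from DFunLike.congr_fun h a
  refine SAlg.linearMap_ext fun l => ?_
  suffices h : ∀ i j, (i, j) ≠ (0, 1) →
      superDerMatrix p v hv (word F C l) i j = f (word F C l) i j by
    ext i j
    by_cases hij : (i, j) = (0, 1)
    · rw [Prod.mk.injEq] at hij
      obtain ⟨rfl, rfl⟩ := hij
      simp [f, superDer]
    · exact h i j hij
  induction l with
  | nil => intro i j _; fin_cases i <;> fin_cases j <;> simp_all [f]
  | cons x l ih =>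
    have h00 := ih 0 0 (by simp)
    have h10 := ih 1 0 (by simp)
    have h11 := ih 1 1 (by simp)
    intro i j hij
    have hx : superDerMatrix p v hv (gen F C x) = !![twist p (gen F C x), v x; 0, gen F C x] := by
      simp [superDerMatrix]
    rw [word_cons, map_mul, hx]
    fin_cases i <;> fin_cases j
    · simp_all [f, Matrix.mul_apply, Fin.sum_univ_two]
    · exact absurd rfl hij
    · simp_all [f, Matrix.mul_apply, Fin.sum_univ_two]
    · simp_all [f, Matrix.mul_apply, Fin.sum_univ_two]

@[simp] theorem superDer_gen (x : Gen F) : superDer p v hv (gen F C x) = v x := by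
  simp [superDer, superDerMatrix]

theorem superDer_mul (a b : SAlg F C) :
    superDer p v hv (a * b) = superDer p v hv a * b + twist p a * superDer p v hv b := by
  have := congr_fun (congr_fun (map_mul (superDerMatrix p v hv) a b) 0) 1
  simpa [superDerMatrix_apply, Matrix.mul_apply, Fin.sum_univ_two, add_comm] using this

theorem superDer_mul_of_mem {e : ZMod 2} {a : SAlg F C} (ha : a ∈ parityPart F C e)
    (b : SAlg F C) : superDer p v hv (a * b) =
      superDer p v hv a * b + sgn (p * e) • (a * superDer p v hv b) := by
  rw [superDer_mul, twist_of_mem ha, smul_mul_assoc]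

@[simp] theorem superDer_one : superDer p v hv 1 = 0 := by
  have := superDer_mul p v hv 1 1
  simpa using this

theorem superDer_gen_mul (x : Gen F) (b : SAlg F C) : superDer p v hv (gen F C x * b) =
      v x * b + sgn (p * x.parity) • (gen F C x * superDer p v hv b) := by
  rw [superDer_mul_of_mem p v hv (gen_mem_parityPart x), superDer_gen]

/-- By the Leibniz rule the image of a word is a signed sum of words with one letter `x` replaced by
`v x`; a submodule does not see the signs. -/
theorem superDer_word_mem {S : Submodule C (SAlg F C)} {l : List (Gen F)}
    (h : ∀ l₁ x l₂, l = l₁ ++ x :: l₂ → word F C l₁ * v x * word F C l₂ ∈ S) :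
    superDer p v hv (word F C l) ∈ S := by
  induction l generalizing S with
  | nil => simp
  | cons x l ih =>
    rw [word_cons, superDer_gen_mul]
    refine S.add_mem (by simpa using h [] x l rfl) (zsmul_mem ?_ _)
    refine ih (S := S.comap (LinearMap.mulLeft C (gen F C x))) fun l₁ y l₂ hl => ?_
    simpa [mul_assoc] using h (x :: l₁) y l₂ (by simp [hl])

theorem superDer_mem {P : List (Gen F) → Prop} {S : Submodule C (SAlg F C)}
    (h : ∀ l₁ x l₂, P (l₁ ++ x :: l₂) → word F C l₁ * v x * word F C l₂ ∈ S)
    {a : SAlg F C} (ha : a ∈ wordSpan F C P) : superDer p v hv a ∈ S := by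
  have : wordSpan F C P ≤ S.comap (superDer p v hv) :=
    wordSpan_le.2 fun l hl => superDer_word_mem p v hv fun l₁ x l₂ e => h l₁ x l₂ (e ▸ hl)
  exact this ha

/-- The values on generators determine a superderivation on the monomials in these. -/
theorem superDer_eq_zero {P : Gen F → Prop} (h : ∀ x, P x → v x = 0) {a : SAlg F C}
    (ha : a ∈ wordSpan F C fun l => ∀ x ∈ l, P x) : superDer p v hv a = 0 := by
  have : superDer p v hv a ∈ (⊥ : Submodule C (SAlg F C)) :=
    superDer_mem p v hv (fun l₁ x l₂ hl => by simp [h x (hl x (by simp))]) ha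
  simpa using this

end Derivation

end SuperAlgebra

end KoszulTate

namespace KoszulTate

variable {F : FieldContent}

section SuperAlgebra

variable {C : Type} [CommRing C]

/-! ### Homogeneous superderivations -/

section Weight

variable {p : ZMod 2} {v : Gen F → SAlg F C} {hv : ∀ x, v x ∈ parityPart F C (x.parity + p)}
  {M : Type*} [AddCommGroup M] {f : Gen F → M} {m : M}

/-- A predicate `Q` instead of a fixed weight also covers the complement of a weight, which
`superDer_proj` uses to separate homogeneous parts. -/
theorem superDer_mem_weight (hf : ∀ x, v x ∈ wordSpan F C fun l => (l.map f).sum = f x + m)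
    (Q : M → Prop) {a : SAlg F C} (ha : a ∈ wordSpan F C fun l => Q ((l.map f).sum + m)) :
    superDer p v hv a ∈ wordSpan F C fun l => Q (l.map f).sum := by
  refine superDer_mem p v hv (fun l₁ x l₂ hl => ?_) ha
  have h₁ : word F C l₁ ∈ wordSpan F C fun l => l = l₁ := word_mem_wordSpan rfl
  have h₂ : word F C l₂ ∈ wordSpan F C fun l => l = l₂ := word_mem_wordSpan rfl
  refine mul_mem_wordSpan (P := fun l => (l.map f).sum = (l₁.map f).sum + (f x + m)) ?_
    (mul_mem_wordSpan ?_ h₁ (hf x)) h₂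
  · rintro l _ h rfl
    convert hl using 1
    simp [h]
    abel
  · rintro _ l rfl h
    simp [h]

theorem superDer_mem_weight_eq (hf : ∀ x, v x ∈ wordSpan F C fun l => (l.map f).sum = f x + m)
    {w : M} {a : SAlg F C} (ha : a ∈ wordSpan F C fun l => (l.map f).sum = w) :
    superDer p v hv a ∈ wordSpan F C fun l => (l.map f).sum = w + m :=
  superDer_mem_weight hf (fun n => n = w + m) (by simpa using ha)

/-- A homogeneous element in the image of a homogeneous superderivation is the image of
the homogeneous part of any preimage. -/
theorem superDer_proj (hf : ∀ x, v x ∈ wordSpan F C fun l => (l.map f).sum = f x + m)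
    {w : M} {a b : SAlg F C} (hb : b ∈ wordSpan F C fun l => (l.map f).sum = w + m)
    (h : superDer p v hv a = b) :
    superDer p v hv (proj (fun l => (l.map f).sum = w) a) = b := by
  have hw := permInvariant_sum f (fun n => n = w)
  have h₁ := superDer_mem_weight_eq (hv := hv) hf
    (wordSpan_mono (fun _ h => h.2) (proj_mem hw (mem_wordSpan_true a)))
  have h₂ := superDer_mem_weight (hv := hv) hf (fun n => n ≠ w + m)
    (by simpa using sub_proj_mem hw a)
  rw [map_sub, h] at h₂
  exact (sub_eq_zero.1 (eq_zero_of_mem_wordSpan (permInvariant_sum f (fun n => n = w + m))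
    (fun l hl => hl) h₂ (Submodule.sub_mem _ hb h₁))).symm

end Weight

theorem superDer_mem_parityPart {p : ZMod 2} {v : Gen F → SAlg F C}
    {hv : ∀ x, v x ∈ parityPart F C (x.parity + p)} {e : ZMod 2} {a : SAlg F C}
    (ha : a ∈ parityPart F C e) : superDer p v hv a ∈ parityPart F C (e + p) :=
  superDer_mem_weight_eq hv ha

theorem superDer_mem_afnPart {p : ZMod 2} {v : Gen F → SAlg F C}
    {hv : ∀ x, v x ∈ parityPart F C (x.parity + p)}
    (hv' : ∀ x, v x ∈ afnPart F C (x.afn - 1)) {j : ℤ} {a : SAlg F C}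
    (ha : a ∈ afnPart F C j) : superDer p v hv a ∈ afnPart F C (j - 1) :=
  superDer_mem_weight_eq (m := -1) hv' ha

/-- The combined grading by antifield number and Grassmann parity. -/
def Gen.bidegree (x : Gen F) : ℤ × ZMod 2 := (x.afn, x.parity)

theorem sum_bidegree (l : List (Gen F)) :
    (l.map Gen.bidegree).sum = ((l.map Gen.afn).sum, (l.map Gen.parity).sum) := by
  induction l with
  | nil => rfl
  | cons x l ih => simp [ih, Gen.bidegree]

theorem mem_bidegree_iff {j : ℤ} {e : ZMod 2} {a : SAlg F C} :
    (a ∈ wordSpan F C fun l => (l.map Gen.bidegree).sum = (j, e)) ↔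
      a ∈ afnPart F C j ∧ a ∈ parityPart F C e := by
  constructor
  · intro h
    constructor <;> refine wordSpan_mono (fun l hl => ?_) h <;>
      simp_all [sum_bidegree]
  · rintro ⟨h, h'⟩
    refine wordSpan_mono (fun l hl => ?_)
      (mem_wordSpan_and (permInvariant_sum Gen.parity (fun n => n = e)) h h')
    simp_all [sum_bidegree]

/-! ### Monomials in the antifields -/

/-- Every monomial is a monomial in the antifields times one in the fields. -/
theorem exists_perm_antifields_append (l : List (Gen F)) :
    ∃ (a : List (Σ t, Fin (F.mult t))) (l' : List (Gen F)), l'.countP Gen.isAntifield = 0 ∧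
      l.Perm ((a.map fun y => Gen.af y.1 y.2) ++ l') := by
  induction l with
  | nil => exact ⟨[], [], rfl, .nil⟩
  | cons x l ih =>
    obtain ⟨a, l', h, hp⟩ := ih
    cases x with
    | theta i =>
      exact ⟨a, .theta i :: l', by simp [h, Gen.isAntifield],
        (hp.cons _).trans List.perm_middle.symm⟩
    | af t α => exact ⟨⟨t, α⟩ :: a, l', h, hp.cons _⟩

theorem sum_afn_eq_zero {l : List (Gen F)} (h : l.countP Gen.isAntifield = 0) :
    (l.map Gen.afn).sum = 0 := by
  induction l with
  | nil => rfl
  | cons x l ih => cases x <;> simp_all [Gen.isAntifield, Gen.afn]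

theorem sum_afn_nonneg (l : List (Gen F)) : 0 ≤ (l.map Gen.afn).sum := by
  refine List.sum_nonneg fun n hn => ?_
  obtain ⟨x, -, rfl⟩ := List.mem_map.1 hn
  cases x
  · exact le_rfl
  · simp only [Gen.afn]; positivity

theorem countP_isAntifield_le_sum_afn (l : List (Gen F)) :
    (l.countP Gen.isAntifield : ℤ) ≤ (l.map Gen.afn).sum := by
  induction l with
  | nil => simp
  | cons x l ih =>
    cases x <;> simp [Gen.isAntifield, Gen.afn, List.countP_cons]
    · exact ih
    · linarith

/-- Each antifield other than `x` contributes at least one to the antifield number. This bounds the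
stage of any letter in a term with several antifields. -/
theorem afn_add_countP_le {l : List (Gen F)} {x : Gen F} (hx : x ∈ l) :
    x.afn + (l.countP Gen.isAntifield - 1) ≤ (l.map Gen.afn).sum := by
  obtain ⟨l₁, l₂, rfl⟩ := List.append_of_mem hx
  have h₁ := countP_isAntifield_le_sum_afn l₁
  have h₂ := countP_isAntifield_le_sum_afn l₂
  cases x <;> simp [Gen.isAntifield, List.countP_cons, Gen.afn] <;> linarith

/-- Expansion in monomials in the antifields with coefficients that depend on the fields only. -/
theorem exists_normalForm {ι : Type*} [Fintype ι] (m : ι → List (Gen F)) (e : ZMod 2)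
    (K : Submodule C (SAlg F C)) {P : List (Gen F) → Prop}
    (hP : ∀ l, P l → (l.map Gen.parity).sum = e ∧ (word F C l ∈ K ∨
      ∃ i l', l'.countP Gen.isAntifield = 0 ∧ l.Perm (m i ++ l')))
    {x : SAlg F C} (hx : x ∈ wordSpan F C P) :
    ∃ N : ι → SAlg F C, (∀ i, N i ∈ phiPart F C ∧
        N i ∈ parityPart F C (e + ((m i).map Gen.parity).sum)) ∧
      x - ∑ i, word F C (m i) * N i ∈ K := by
  classical
  induction hx using Submodule.span_induction with
  | mem x hx =>
    obtain ⟨l, hl, rfl⟩ := hx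
    obtain ⟨he, h | ⟨i, l', hl', hp⟩⟩ := hP l hl
    · exact ⟨0, fun i => ⟨Submodule.zero_mem _, Submodule.zero_mem _⟩, by simpa using h⟩
    · obtain ⟨n, -, hn⟩ := word_perm (C := C) hp
      refine ⟨Pi.single i (n • word F C l'), fun j => ?_, ?_⟩
      · obtain rfl | hj := eq_or_ne j i
        · rw [Pi.single_eq_same]
          refine ⟨zsmul_mem_wordSpan _ (word_mem_wordSpan hl'),
            zsmul_mem_wordSpan _ (word_mem_wordSpan ?_)⟩
          rw [← he, (hp.map _).sum_eq]
          simp only [List.map_append, List.sum_append]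
          -- The coefficient has the total parity minus that of the antifields; modulo two the
          -- difference is a sum.
          rw [add_right_comm, CharTwo.add_self_eq_zero, zero_add]
        · rw [Pi.single_eq_of_ne hj]
          exact ⟨Submodule.zero_mem _, Submodule.zero_mem _⟩
      · rw [Finset.sum_eq_single i (fun j _ hj => by rw [Pi.single_eq_of_ne hj, mul_zero])
          (by simp), Pi.single_eq_same, hn, word_append, mul_smul_comm, sub_self]
        exact Submodule.zero_mem _
  | zero => exact ⟨0, fun i => ⟨Submodule.zero_mem _, Submodule.zero_mem _⟩, by simp⟩
  | add x y _ _ hx hy =>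
    obtain ⟨N, hN, h⟩ := hx
    obtain ⟨N', hN', h'⟩ := hy
    refine ⟨N + N', fun i => ⟨Submodule.add_mem _ (hN i).1 (hN' i).1,
      Submodule.add_mem _ (hN i).2 (hN' i).2⟩, ?_⟩
    simp only [Pi.add_apply, mul_add, Finset.sum_add_distrib]
    rw [add_sub_add_comm]
    exact K.add_mem h h'
  | smul c x _ hx =>
    obtain ⟨N, hN, h⟩ := hx
    refine ⟨c • N, fun i => ⟨Submodule.smul_mem _ _ (hN i).1,
      Submodule.smul_mem _ _ (hN i).2⟩, ?_⟩
    simp only [Pi.smul_apply, mul_smul_comm, ← Finset.smul_sum]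
    rw [← smul_sub]
    exact K.smul_mem c h

/-- The antifields of a given stage are linearly independent over the functions of the fields,
even modulo terms with two antifields. -/
theorem eq_zero_of_sum_mul_mem_orderAf {t : ℕ} {f : Fin (F.mult t) → SAlg F C}
    (hf : ∀ α, f α ∈ phiPart F C) (h : ∑ α, gen F C (.af t α) * f α ∈ orderAf F C 2)
    (α : Fin (F.mult t)) : f α = 0 := by
  classical
  -- The left derivative with respect to the antifield `.af t α`; it maps the sum to `f α`.
  let v : Gen F → SAlg F C := fun x => if x = .af t α then 1 else 0
  have hv : ∀ x, v x ∈ parityPart F C (x.parity + (Gen.af t α : Gen F).parity) := fun x => by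
    by_cases hx : x = .af t α
    · simpa [v, hx, CharTwo.add_self_eq_zero] using one_mem_parityPart
    · simp [v, hx]
  have hphi : ∀ a ∈ phiPart F C, superDer _ v hv a = 0 := fun a ha =>
    superDer_eq_zero _ v hv (P := fun x => x.isAntifield = false)
      (fun x hx => if_neg (by rintro rfl; simp [Gen.isAntifield] at hx))
      (wordSpan_mono (fun l hl => by simpa [List.countP_eq_zero] using hl) ha)
  have h1 : superDer _ v hv (∑ β, gen F C (.af t β) * f β) = f α := by
    rw [map_sum, Finset.sum_eq_single α]
    · rw [superDer_gen_mul, hphi _ (hf α)]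
      simp [v]
    · intro β _ hβ
      rw [superDer_gen_mul, hphi _ (hf β)]
      simp [v, hβ]
    · simp
  -- Differentiating a term with two antifields leaves at least one, whereas `f α` contains none.
  have h2 : f α ∈ wordSpan F C fun l => 1 ≤ l.countP Gen.isAntifield := by
    rw [← h1]
    refine superDer_mem _ v hv (fun l₁ x l₂ hl => ?_) h
    by_cases hx : x = .af t α
    · have : word F C l₁ * v x * word F C l₂ = word F C (l₁ ++ l₂) := by
        simp [v, hx, word_append]
      rw [this]
      apply word_mem_wordSpan
      simp [List.countP_cons] at hl ⊢
      split_ifs at hl <;> omega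
    · simp [v, hx]
  exact eq_zero_of_mem_wordSpan (permInvariant_countP _ (fun n => 1 ≤ n)) (fun l hl => by omega)
    (hf α) h2

/-! ### The subcomplexes -/

/-- The generators of the `k`th complex. -/
def Gen.InCpx (k : ℤ) : Gen F → Prop
  | theta _ => True
  | af t _ => (t : ℤ) - 1 ≤ k

theorem Gen.InCpx.mono {k l : ℤ} (h : k ≤ l) {x : Gen F} (hx : x.InCpx k) : x.InCpx l := by
  cases x
  · trivial
  · exact le_trans hx h

theorem gen_mem_cpx {k : ℤ} {x : Gen F} (hx : x.InCpx k) : gen F C x ∈ cpx F C k := by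
  cases x with
  | theta i => exact Algebra.subset_adjoin (Or.inl ⟨i, rfl⟩)
  | af t α => exact Algebra.subset_adjoin (Or.inr ⟨t, α, hx, rfl⟩)

theorem word_mem_cpx {k : ℤ} {l : List (Gen F)} (hl : ∀ x ∈ l, x.InCpx k) :
    word F C l ∈ cpx F C k :=
  Subalgebra.list_prod_mem _ fun a ha => by
    obtain ⟨x, hx, rfl⟩ := List.mem_map.1 ha
    exact gen_mem_cpx (hl x hx)

theorem mem_cpx_iff {k : ℤ} {a : SAlg F C} :
    a ∈ cpx F C k ↔ a ∈ wordSpan F C fun l => ∀ x ∈ l, x.InCpx k := by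
  constructor
  · intro h
    let S : Subalgebra C (SAlg F C) :=
      (wordSpan F C fun l => ∀ x ∈ l, x.InCpx k).toSubalgebra
        (word_mem_wordSpan (l := []) (by simp))
        (fun a b ha hb => mul_mem_wordSpan (fun l l' h h' x hx => by
          rcases List.mem_append.1 hx with hx | hx
          · exact h x hx
          · exact h' x hx) ha hb)
    have : cpx F C k ≤ S := by
      refine Algebra.adjoin_le ?_
      rintro _ (⟨i, rfl⟩ | ⟨t, α, ht, rfl⟩)
      · rw [← word_singleton]
        exact word_mem_wordSpan (P := fun l => ∀ x ∈ l, x.InCpx k) (by simp [Gen.InCpx])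
      · rw [← word_singleton]
        exact word_mem_wordSpan (P := fun l => ∀ x ∈ l, x.InCpx k) (by simpa [Gen.InCpx] using ht)
    exact this h
  · intro h
    have : wordSpan F C (fun l => ∀ x ∈ l, x.InCpx k) ≤ (cpx F C k).toSubmodule :=
      wordSpan_le.2 fun l hl => word_mem_cpx hl
    exact this h

theorem cpx_mono {k l : ℤ} (h : k ≤ l) : cpx F C k ≤ cpx F C l := fun _ ha =>
  mem_cpx_iff.2 (wordSpan_mono (fun _ hl x hx => (hl x hx).mono h) (mem_cpx_iff.1 ha))

theorem mem_cpx_of_mem_phiPart {k : ℤ} {a : SAlg F C} (ha : a ∈ phiPart F C) : a ∈ cpx F C k :=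
  mem_cpx_iff.2 (wordSpan_mono (fun l hl x hx => by
    rw [List.countP_eq_zero] at hl
    cases x with
    | theta i => trivial
    | af t α => exact absurd rfl (hl _ hx)) ha)

/-- An antifield of stage `s` has antifield number `s + 2`, so it fits into a term of antifield
number `j` only if `s ≤ j - 2`. For negative `j` there are no terms at all. -/
theorem mem_cpx_of_mem_afnPart {j k : ℤ} (hk : 0 ≤ j → j ≤ k + 2) {a : SAlg F C}
    (ha : a ∈ afnPart F C j) : a ∈ cpx F C k :=
  mem_cpx_iff.2 (wordSpan_mono (fun l hl x hx => by
    have h := afn_add_countP_le hx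
    have h0 := sum_afn_nonneg l
    cases x with
    | theta i => trivial
    | af t α =>
      have h1 : 0 < l.countP Gen.isAntifield := List.countP_pos_iff.2 ⟨_, hx, rfl⟩
      have h2 := hk (hl ▸ h0)
      simp only [Gen.InCpx, Gen.afn] at h ⊢
      omega) ha)

/-! ### Change of coefficients -/

section Map

variable {D : Type} [CommRing D] (f : C →+* D)

@[simp] theorem SAlg.map_gen (x : Gen F) : SAlg.map F f (gen F C x) = gen F D x := by
  simp [SAlg.map, gen]

theorem SAlg.map_smul (c : C) (a : SAlg F C) : SAlg.map F f (c • a) = f c • SAlg.map F f a := by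
  let _ : Algebra C (SAlg F D) :=
    ((algebraMap D (SAlg F D)).comp f).toAlgebra' fun c x => Algebra.commutes (f c) x
  rw [Algebra.smul_def (f c)]
  exact _root_.map_smul (RingQuot.liftAlgHom C (s := SuperComm F C)
    ⟨FreeAlgebra.lift C (gen F D), by
      rintro _ _ ⟨x, y⟩
      simpa using gen_comm x y⟩ : SAlg F C →ₐ[C] SAlg F D) c a

@[simp] theorem SAlg.map_word (l : List (Gen F)) : SAlg.map F f (word F C l) = word F D l := by
  induction l with
  | nil => simp
  | cons x l ih => simp [ih]

theorem SAlg.map_mem {P : List (Gen F) → Prop} {a : SAlg F C} (ha : a ∈ wordSpan F C P) :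
    SAlg.map F f a ∈ wordSpan F D P := by
  induction ha using Submodule.span_induction with
  | mem x hx =>
    obtain ⟨l, hl, rfl⟩ := hx
    rw [SAlg.map_word]
    exact word_mem_wordSpan hl
  | zero => simp
  | add x y _ _ hx hy =>
    rw [map_add]
    exact Submodule.add_mem _ hx hy
  | smul c x _ hx =>
    rw [SAlg.map_smul]
    exact Submodule.smul_mem _ _ hx

open TensorProduct in
/-- A map backwards between the coefficient rings that is linear over the smaller one induces
a map backwards between the algebras. -/
theorem SAlg.exists_transfer (e : D →+ C) (he : ∀ c d, e (f c * d) = c * e d) :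
    ∃ T : SAlg F D →+ SAlg F C, ∀ d l, T (d • word F D l) = e d • word F C l := by
  let _ : Algebra C D := f.toAlgebra
  -- The algebra over `D` maps to the base change of the algebra over `C`; applying `e` to the
  -- factor `D` then gives the transfer.
  let j : SAlg F D →ₐ[D] D ⊗[C] SAlg F C := SAlg.lift (C := D) (R := D ⊗[C] SAlg F C)
    (fun x => 1 ⊗ₜ gen F C x) fun x y => by
      rw [Algebra.TensorProduct.tmul_mul_tmul, Algebra.TensorProduct.tmul_mul_tmul, gen_comm x y,
        ← TensorProduct.tmul_smul]
  have hj : ∀ l, j (word F D l) = 1 ⊗ₜ word F C l := fun l => by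
    induction l with
    | nil => simp [Algebra.TensorProduct.one_def]
    | cons x l ih =>
      rw [word_cons, map_mul, ih, SAlg.lift_gen, Algebra.TensorProduct.tmul_mul_tmul, word_cons,
        one_mul]
  let e' : D →ₗ[C] C :=
    { toFun := e
      map_add' := e.map_add
      map_smul' := fun c d => by
        rw [Algebra.smul_def]
        exact he c d }
  let T : D ⊗[C] SAlg F C →ₗ[C] SAlg F C :=
    (TensorProduct.lid C (SAlg F C)).toLinearMap ∘ₗ e'.rTensor (SAlg F C)
  refine ⟨T.toAddMonoidHom.comp j.toLinearMap.toAddMonoidHom, fun d l => ?_⟩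
  have : j (d • word F D l) = d ⊗ₜ word F C l := by
    rw [_root_.map_smul, hj, TensorProduct.smul_tmul', smul_eq_mul, mul_one]
  simp only [AddMonoidHom.comp_apply, LinearMap.toAddMonoidHom_coe, AlgHom.toLinearMap_apply]
  rw [this]
  simp [T, e']

/-- Induction on linear combinations of monomials. -/
theorem wordSpan_induction {P : List (Gen F) → Prop} {Q : SAlg F C → Prop} (h0 : Q 0)
    (hadd : ∀ a b, Q a → Q b → Q (a + b)) (hword : ∀ (c : C) l, P l → Q (c • word F C l))
    {a : SAlg F C} (ha : a ∈ wordSpan F C P) : Q a := by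
  induction ha using Submodule.closure_induction with
  | zero => exact h0
  | add x y _ _ hx hy => exact hadd x y hx hy
  | smul_mem c x hx =>
    obtain ⟨l, hl, rfl⟩ := hx
    exact hword c l hl

section Transfer

variable {f} {e : D →+ C} {T : SAlg F D →+ SAlg F C}

theorem SAlg.transfer_mem (hT : ∀ d l, T (d • word F D l) = e d • word F C l)
    {P : List (Gen F) → Prop} {a : SAlg F D} (ha : a ∈ wordSpan F D P) :
    T a ∈ wordSpan F C P := by
  refine wordSpan_induction (Q := fun a => T a ∈ wordSpan F C P) ?_ (fun a b ha hb => ?_)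
    (fun c l hl => ?_) ha
  · simp
  · rw [map_add]
    exact Submodule.add_mem _ ha hb
  · rw [hT]
    exact Submodule.smul_mem _ _ (word_mem_wordSpan hl)

/-- A projection formula: the transfer is linear over the algebra with coefficients in `C`.
Relations among restricted functions therefore survive extension by zero. -/
theorem SAlg.transfer_map_mul (hT : ∀ d l, T (d • word F D l) = e d • word F C l)
    (he : ∀ c d, e (f c * d) = c * e d) (a : SAlg F C) (b : SAlg F D) :
    T (SAlg.map F f a * b) = a * T b := by
  refine wordSpan_induction (Q := fun a => T (SAlg.map F f a * b) = a * T b) ?_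
    (fun a a' ha ha' => ?_) (fun c l _ => ?_) (mem_wordSpan_true a)
  · simp
  · rw [map_add, add_mul, map_add, ha, ha', add_mul]
  · refine wordSpan_induction
      (Q := fun b => T (SAlg.map F f (c • word F C l) * b) = (c • word F C l) * T b) ?_
      (fun b b' hb hb' => ?_) (fun d l' _ => ?_) (mem_wordSpan_true b)
    · simp
    · rw [mul_add, map_add, hb, hb', map_add, mul_add]
    · rw [SAlg.map_smul, SAlg.map_word, smul_mul_smul_comm, ← word_append, hT, hT, he,
        smul_mul_smul_comm, word_append]

theorem SAlg.map_transfer (hT : ∀ d l, T (d • word F D l) = e d • word F C l) {χ : D}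
    (he : ∀ d, f (e d) = χ * d) (b : SAlg F D) : SAlg.map F f (T b) = χ • b := by
  refine wordSpan_induction (Q := fun b => SAlg.map F f (T b) = χ • b) ?_
    (fun b b' hb hb' => ?_) (fun d l _ => ?_) (mem_wordSpan_true b)
  · simp
  · rw [map_add, map_add, hb, hb', smul_add]
  · rw [hT, SAlg.map_smul, SAlg.map_word, he, smul_smul]

end Transfer

end Map

/-! ### Nilpotency of the odd fields -/

/-- By the pigeonhole principle an odd field occurs twice. Moving both copies together costs a sign,
and their square vanishes because it equals its own negative and `2` is invertible. -/
theorem word_eq_zero_of_card_lt (h2 : IsUnit (2 : C)) {l : List (Gen F)}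
    (hl : l.countP Gen.isAntifield = 0) (hc : Fintype.card (OddIx F) < l.length) :
    word F C l = 0 := by
  have hl' : ∃ t : List (OddIx F), l = t.map Gen.theta := by
    clear hc
    induction l with
    | nil => exact ⟨[], rfl⟩
    | cons x l ih =>
      cases x with
      | theta i =>
        obtain ⟨t, rfl⟩ := ih (by simpa [Gen.isAntifield] using hl)
        exact ⟨i :: t, rfl⟩
      | af t α => simp [Gen.isAntifield] at hl
  obtain ⟨t, rfl⟩ := hl'
  have hd : ¬ t.Nodup := fun h => by
    have := h.length_le_card
    rw [List.length_map] at hc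
    omega
  obtain ⟨i, hi⟩ := List.exists_duplicate_iff_not_nodup.2 hd
  obtain ⟨t', ht'⟩ := (List.duplicate_iff_sublist.1 hi).exists_perm_append
  obtain ⟨n, -, hn⟩ := word_perm (C := C) (ht'.map Gen.theta)
  have hsq : gen F C (.theta i) * gen F C (.theta i) = 0 := by
    have h : gen F C (.theta i) * gen F C (.theta i) =
        -(gen F C (.theta i) * gen F C (.theta i)) := by
      have h := gen_comm (C := C) (.theta i : Gen F) (.theta i)
      rwa [show sgn ((Gen.theta i : Gen F).parity * (Gen.theta i : Gen F).parity) = -1 from rfl,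
        neg_one_zsmul] at h
    have h' : (2 : C) • (gen F C (.theta i) * gen F C (.theta i)) = 0 := by
      rw [two_smul]
      nth_rewrite 1 [h]
      exact neg_add_cancel _
    exact (h2.smul_eq_zero).1 h'
  rw [hn]
  simp [← mul_assoc, hsq]

/-- A function of the fields without constant term is nilpotent. -/
theorem isNilpotent_of_mem (h2 : IsUnit (2 : C)) {a : SAlg F C}
    (ha : a ∈ wordSpan F C fun l => l.countP Gen.isAntifield = 0 ∧ 1 ≤ l.length) :
    IsNilpotent a := by
  have h : ∀ n : ℕ, a ^ n ∈ wordSpan F C fun l => l.countP Gen.isAntifield = 0 ∧ n ≤ l.length := by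
    intro n
    induction n with
    | zero =>
      rw [pow_zero, ← word_nil]
      exact word_mem_wordSpan (P := fun l => l.countP Gen.isAntifield = 0 ∧ 0 ≤ l.length)
        ⟨rfl, le_rfl⟩
    | succ n ih =>
      rw [pow_succ]
      refine mul_mem_wordSpan (fun l l' h h' => ?_) ih ha
      simp only [List.countP_append, List.length_append]
      omega
  refine ⟨Fintype.card (OddIx F) + 1, ?_⟩
  have h' : a ^ (Fintype.card (OddIx F) + 1) ∈ (⊥ : Submodule C (SAlg F C)) :=
    wordSpan_le.2 (fun l hl => by
      rw [word_eq_zero_of_card_lt h2 hl.1 hl.2]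
      exact Submodule.zero_mem _) (h (Fintype.card (OddIx F) + 1))
  simpa using h'

end SuperAlgebra

end KoszulTate

namespace KoszulTate

variable {F : FieldContent}

/-! ### Cutoff functions -/

section Smooth

variable {Ω U V : Opens (Base F)}

theorem Smooth.contMDiffAt_extend (f : Smooth F V) {x : Base F} (hx : x ∈ V) :
    ContMDiffAt 𝓘(ℝ, Base F) 𝓘(ℝ, ℝ) ∞ (Function.extend ((↑) : V → Base F) f 0) x := by
  have h : (fun y : V => Function.extend ((↑) : V → Base F) f 0 (y : Base F)) = f := by
    funext y
    exact Subtype.val_injective.extend_apply f 0 y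
  have := f.contMDiff ⟨x, hx⟩
  rw [← h] at this
  exact contMDiffAt_subtype_iff.1 this

theorem extend_apply_of_notMem (f : V → ℝ) {x : Base F} (hx : x ∉ V) :
    Function.extend ((↑) : V → Base F) f 0 x = 0 :=
  Function.extend_apply' _ _ _ (by rintro ⟨y, rfl⟩; exact hx y.2)

open Filter Topology in
/-- Multiplication by a function that vanishes near the complement of `V`, followed by extension
by zero. -/
theorem Smooth.exists_extension (hV : V ≤ U) (χ : Smooth F U)
    (hχ : ∀ x : U, (x : Base F) ∉ V → ∀ᶠ y in 𝓝 x, χ y = 0) :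
    ∃ e : Smooth F V →+ Smooth F U, (∀ c d, e (Smooth.res F hV c * d) = c * e d) ∧
      ∀ d, Smooth.res F hV (e d) = Smooth.res F hV χ * d := by
  let g : Smooth F V → U → ℝ := fun d x => χ x * Function.extend ((↑) : V → Base F) d 0 (x : Base F)
  have hg : ∀ d, ContMDiff 𝓘(ℝ, Base F) 𝓘(ℝ, ℝ) ∞ (g d) := fun d x => by
    by_cases hx : (x : Base F) ∈ V
    · exact (χ.contMDiff x).mul (contMDiffAt_subtype_iff.2 (d.contMDiffAt_extend hx))
    -- At a point outside `V` the factor `χ` vanishes on a whole neighbourhood, so the discontinuity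
    -- of the zero extension is harmless.
    · refine (contMDiffAt_const (c := (0 : ℝ))).congr_of_eventuallyEq ?_
      filter_upwards [hχ x hx] with y hy
      simp [g, hy]
  have hgV : ∀ d (x : U) (hx : (x : Base F) ∈ V), g d x = χ x * d ⟨x, hx⟩ := fun d x hx =>
    congrArg (χ x * ·) (Subtype.val_injective.extend_apply d 0 (⟨x, hx⟩ : V))
  have hgV' : ∀ d (x : U), (x : Base F) ∉ V → g d x = 0 := fun d x hx => by
    simp [g, extend_apply_of_notMem _ hx]
  refine ⟨⟨⟨fun d => ⟨g d, hg d⟩, ?_⟩, ?_⟩, ?_, ?_⟩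
  · ext x
    by_cases hx : (x : Base F) ∈ V
    · exact (hgV _ x hx).trans (mul_zero _)
    · exact hgV' _ x hx
  · intro d d'
    ext x
    by_cases hx : (x : Base F) ∈ V
    · refine (hgV _ x hx).trans ?_
      refine Eq.trans ?_ (congrArg₂ (· + ·) (hgV d x hx) (hgV d' x hx)).symm
      exact mul_add _ _ _
    · refine (hgV' _ x hx).trans ?_
      refine Eq.trans ?_ (congrArg₂ (· + ·) (hgV' d x hx) (hgV' d' x hx)).symm
      exact (add_zero _).symm
  · intro c d
    ext x
    by_cases hx : (x : Base F) ∈ V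
    · refine (hgV _ x hx).trans ?_
      refine Eq.trans ?_ (congrArg (c x * ·) (hgV d x hx)).symm
      exact mul_left_comm _ _ _
    · refine (hgV' _ x hx).trans ?_
      refine Eq.trans ?_ (congrArg (c x * ·) (hgV' d x hx)).symm
      exact (mul_zero _).symm
  · intro d
    ext x
    exact hgV d ⟨x, hV x.2⟩ x.2

open Filter Topology in
/-- A cutoff function `χ` that is one near the stationary surface and supported in `V`, such that
`1 - χ` is a multiple of the sum of the squares of the bodies of the field equations. -/
theorem SuperFn.exists_cutoff (S₀ : SuperFn Ω) (hU : U ≤ Ω) (hV : V ≤ U)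
    (hS : S₀.stationarySurface ⊆ (V : Set (Base F))) :
    ∃ (χ : Smooth F U) (η : Smooth F V),
      (∀ x : U, (x : Base F) ∉ V → ∀ᶠ y in 𝓝 x, χ y = 0) ∧
      η * ∑ i, Smooth.res F (hV.trans hU) (S₀.rightDeriv i ∅) *
        Smooth.res F (hV.trans hU) (S₀.rightDeriv i ∅) = 1 - Smooth.res F hV χ := by
  let t : Set U := ⋂ i, {x | Smooth.res F hU (S₀.rightDeriv i ∅) x = 0}
  let s : Set U := {x | (x : Base F) ∈ (V : Set (Base F))}ᶜ
  have ht : IsClosed t := isClosed_iInter fun i =>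
    isClosed_eq (Smooth.res F hU (S₀.rightDeriv i ∅)).contMDiff.continuous continuous_const
  have hs : IsClosed s := (V.isOpen.preimage continuous_subtype_val).isClosed_compl
  have hd : Disjoint s t := by
    rw [Set.disjoint_left]
    intro x hx hxt
    refine hx (hS ⟨hU x.2, fun i => ?_⟩)
    exact Set.mem_iInter.1 hxt i
  have : LocallyCompactSpace U := U.isOpen.locallyCompactSpace
  -- Smooth separation of the closed sets `U \ V` and the stationary surface inside `U`, disjoint
  -- because the surface lies in `V`: `χ` is zero near the first and one near the second.
  obtain ⟨χ, h0, h1, -⟩ := exists_contMDiffMap_zero_one_nhds_of_isClosed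
    (n := ⊤) 𝓘(ℝ, Base F) hs ht hd
  let Δ : Smooth F V := ∑ i, Smooth.res F (hV.trans hU) (S₀.rightDeriv i ∅) *
        Smooth.res F (hV.trans hU) (S₀.rightDeriv i ∅)
  have hΔ : ∀ x : V, Δ x = ∑ i, (Smooth.res F (hV.trans hU) (S₀.rightDeriv i ∅) x) *
        (Smooth.res F (hV.trans hU) (S₀.rightDeriv i ∅) x) := fun x => by
    have := map_sum (ContMDiffMap.evalRingHom (n := ∞) (I := 𝓘(ℝ, Base F)) (I' := 𝓘(ℝ, ℝ))
      (R := ℝ) x) (fun i => Smooth.res F (hV.trans hU) (S₀.rightDeriv i ∅) *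
        Smooth.res F (hV.trans hU) (S₀.rightDeriv i ∅)) Finset.univ
    exact this
  have hnear : ∀ x : V, Δ x = 0 → ∀ᶠ y : V in 𝓝 x, χ (Set.inclusion hV y) = 1 := by
    intro x hx
    have hxt : Set.inclusion hV x ∈ t := by
      rw [hΔ, Finset.sum_eq_zero_iff_of_nonneg fun i _ => mul_self_nonneg _] at hx
      exact Set.mem_iInter.2 fun i => mul_self_eq_zero.1 (hx i (Finset.mem_univ i))
    exact ((continuous_inclusion hV).tendsto x).eventually
      ((eventually_nhdsSet_iff_forall.1 h1) _ hxt)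
  -- The quotient `(1 - χ) / Δ` is smooth: near a zero of `Δ` the numerator vanishes identically,
  -- and elsewhere `Δ` is invertible.
  have hη : ContMDiff 𝓘(ℝ, Base F) 𝓘(ℝ, ℝ) ∞
      fun x : V => (1 - Smooth.res F hV χ x) * (Δ x)⁻¹ := fun x => by
    by_cases hx : Δ x = 0
    · refine (contMDiffAt_const (c := (0 : ℝ))).congr_of_eventuallyEq ?_
      filter_upwards [hnear x hx] with y hy
      have : Smooth.res F hV χ y = 1 := hy
      simp [this]
    · exact (contMDiffAt_const.sub ((Smooth.res F hV χ).contMDiff x)).mul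
        ((contDiffAt_inv ℝ hx).contMDiffAt.comp x (Δ.contMDiff x))
  refine ⟨χ, ⟨_, hη⟩, fun x hx => (eventually_nhdsSet_iff_forall.1 h0) x hx, ?_⟩
  ext x
  change (1 - Smooth.res F hV χ x) * (Δ x)⁻¹ * Δ x = 1 - Smooth.res F hV χ x
  by_cases hx : Δ x = 0
  · have : Smooth.res F hV χ x = 1 := (hnear x hx).self_of_nhds
    simp [this]
  · rw [inv_mul_cancel_right₀ hx]

end Smooth

/-! ### The field equations -/

section Eom

variable {Ω U V : Opens (Base F)}

theorem isUnit_two_smooth : IsUnit (2 : Smooth F U) := by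
  have : (2 : Smooth F U) = algebraMap ℝ (Smooth F U) 2 := (map_ofNat _ 2).symm
  rw [this]
  exact (isUnit_iff_ne_zero.2 (two_ne_zero)).map _

theorem Alg.res_toAlg (hU : U ≤ Ω) (hV : V ≤ U) (f : SuperFn Ω) :
    Alg.res hV (f.toAlg hU) = f.toAlg (hV.trans hU) := by
  simp only [SuperFn.toAlg, Alg.res, map_sum, SAlg.map_smul, SAlg.map_word]
  rfl

theorem Alg.res_eom (hU : U ≤ Ω) (hV : V ≤ U) (S₀ : SuperFn Ω) (i : Fin (F.mult 0)) :
    Alg.res hV (S₀.eom hU i) = S₀.eom (hV.trans hU) i := Alg.res_toAlg hU hV _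

theorem SuperFn.toAlg_mem_phiPart (hU : U ≤ Ω) (f : SuperFn Ω) :
    f.toAlg hU ∈ phiPart F (Smooth F U) :=
  Submodule.sum_mem _ fun J _ => Submodule.smul_mem _ _ (word_mem_wordSpan (by
    rw [List.countP_eq_zero]
    intro x hx
    obtain ⟨i, -, rfl⟩ := List.mem_map.1 hx
    simp [Gen.isAntifield]))

/-- A function of the fields differs from its body by terms in the odd fields. -/
theorem SuperFn.toAlg_sub_body_mem (hU : U ≤ Ω) (f : SuperFn Ω) :
    f.toAlg hU - algebraMap _ _ (Smooth.res F hU (f ∅)) ∈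
      wordSpan F (Smooth F U) fun l => l.countP Gen.isAntifield = 0 ∧ 1 ≤ l.length := by
  rw [SuperFn.toAlg, ← Finset.add_sum_erase _ _ (Finset.mem_univ ∅), Algebra.algebraMap_eq_smul_one]
  simp only [Finset.sort_empty, List.map_nil, word_nil, add_sub_cancel_left]
  refine Submodule.sum_mem _ fun J hJ => Submodule.smul_mem _ _ (word_mem_wordSpan ⟨?_, ?_⟩)
  · rw [List.countP_eq_zero]
    intro x hx
    obtain ⟨i, -, rfl⟩ := List.mem_map.1 hx
    simp [Gen.isAntifield]
  · rw [List.length_map, Finset.length_sort]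
    exact Finset.card_pos.2 (Finset.nonempty_iff_ne_empty.2 (Finset.ne_of_mem_erase hJ))

/-- The body of the derivative along an odd field is the coefficient of a single `θ`, which is
absent from an even function. -/
theorem SuperFn.rightDeriv_body_eq_zero {S₀ : SuperFn Ω} (hS₀ : S₀.IsEven) {i : Fin (F.mult 0)}
    (hi : F.par 0 i ≠ 0) : S₀.rightDeriv i ∅ = 0 := by
  simp only [SuperFn.rightDeriv, dif_neg hi]
  rw [if_neg (by simp), hS₀ _ (by simp)]
  simp

/-- Away from the stationary surface, the field equations generate the unit ideal. -/
theorem SuperFn.exists_sum_eom_mul_eq {S₀ : SuperFn Ω} (hS₀ : S₀.IsEven) (hU : U ≤ Ω)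
    (hT : ∀ i, S₀.eom hU i ∈ parityPart F (Smooth F U) (F.par 0 i)) {ρ η : Smooth F U}
    (hρ : η * ∑ i, Smooth.res F hU (S₀.rightDeriv i ∅) * Smooth.res F hU (S₀.rightDeriv i ∅) = ρ) :
    ∃ (N : ℕ) (h : Fin (F.mult 0) → Alg U),
      (∀ i, h i ∈ phiPart F (Smooth F U) ∧ h i ∈ parityPart F (Smooth F U) (F.par 0 i)) ∧
      ∑ i, S₀.eom hU i * h i = algebraMap _ _ (ρ ^ N) := by
  let b : Fin (F.mult 0) → Smooth F U := fun i => Smooth.res F hU (S₀.rightDeriv i ∅)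
  let A : Subalgebra (Smooth F U) (Alg U) :=
    (phiPart F (Smooth F U) ⊓ parityPart F (Smooth F U) 0).toSubalgebra
      ⟨word_mem_wordSpan (l := []) (by simp), word_mem_wordSpan (l := []) (by simp)⟩
      fun a a' h h' => ⟨mul_mem_phiPart h.1 h'.1, by simpa using mul_mem_parityPart h.2 h'.2⟩
  -- The field equations of odd index have zero body `b i`, so only even ones enter `w`.
  have hTb : ∀ i, b i • S₀.eom hU i ∈ A := fun i => by
    refine ⟨Submodule.smul_mem _ _ (SuperFn.toAlg_mem_phiPart _ _), ?_⟩
    by_cases hi : F.par 0 i = 0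
    · exact Submodule.smul_mem _ _ (by simpa only [hi] using hT i)
    · simp [b, SuperFn.rightDeriv_body_eq_zero hS₀ hi]
  let w : Alg U := ∑ i, b i • S₀.eom hU i
  have hw : w ∈ A := Subalgebra.sum_mem _ fun i _ => hTb i
  let x : Alg U := algebraMap _ _ ρ
  let y : Alg U := x - η • w
  -- The body of `η • w` is `ρ`, so `y` consists of terms with at least one odd field.
  have hy : IsNilpotent y := by
    refine isNilpotent_of_mem isUnit_two_smooth ?_
    have : y = η • ∑ i, b i • (algebraMap _ _ (b i) - S₀.eom hU i) := by
      simp only [y, x, w, ← hρ, b, Algebra.smul_def, map_mul, map_sum]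
      rw [← mul_sub, ← Finset.sum_sub_distrib]
      refine congrArg _ (Finset.sum_congr rfl fun i _ => ?_)
      rw [mul_sub]
    rw [this]
    exact Submodule.smul_mem _ _ (Submodule.sum_mem _ fun i _ => Submodule.smul_mem _ _
      (sub_mem_comm_iff.1 (SuperFn.toAlg_sub_body_mem hU _)))
  obtain ⟨N, hN⟩ := hy
  have hcomm : Commute x y := Algebra.commutes _ _
  have hxA : x ∈ A := A.algebraMap_mem _
  have hyA : y ∈ A := A.sub_mem hxA (A.smul_mem hw _)
  -- Since `y ^ N = 0`, the factorisation `x ^ N - y ^ N = (x - y) * G` with `x - y = η • w` puts `ρ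
  -- ^ N` into the ideal of the field equations.
  let G : Alg U := ∑ k ∈ Finset.range N, x ^ k * y ^ (N - 1 - k)
  have hG : G ∈ A := Subalgebra.sum_mem _ fun k _ =>
    A.mul_mem (A.pow_mem hxA _) (A.pow_mem hyA _)
  refine ⟨N, fun i => (η * b i) • G, fun i => ⟨Submodule.smul_mem _ _ hG.1, ?_⟩, ?_⟩
  · by_cases hi : F.par 0 i = 0
    · exact Submodule.smul_mem _ _ (by rw [hi]; exact hG.2)
    · simp [b, SuperFn.rightDeriv_body_eq_zero hS₀ hi]
  · have h := hcomm.mul_geom_sum₂ N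
    rw [hN, sub_zero] at h
    rw [map_pow]
    change _ = x ^ N
    rw [← h]
    rw [show x - y = η • w from sub_sub_cancel _ _]
    change _ = η • w * G
    simp only [w, Finset.smul_sum, Finset.sum_mul, smul_smul]
    refine Finset.sum_congr rfl fun i _ => ?_
    rw [mul_smul_comm, smul_mul_assoc]

end Eom

end KoszulTate

namespace KoszulTate

variable {F : FieldContent}

/-! ### Noether identities of the field equations -/

section SuperAlgebra

variable {C : Type} [CommRing C]

/-- Every syzygy of `T` is a combination of the syzygies `R` and of trivial ones. -/
def KoszulExact (T : Fin (F.mult 0) → SAlg F C) (R : Fin (F.mult 0) → Fin (F.mult 1) → SAlg F C) :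
    Prop :=
  ∀ (e : ZMod 2) (E : Fin (F.mult 0) → SAlg F C),
    (∀ i, E i ∈ phiPart F C ∧ E i ∈ parityPart F C (F.par 0 i + e)) → ∑ i, T i * E i = 0 →
    ∃ (X : Fin (F.mult 1) → SAlg F C) (Y : Fin (F.mult 0) → Fin (F.mult 0) → SAlg F C),
      (∀ a, X a ∈ phiPart F C ∧ X a ∈ parityPart F C (F.par 1 a + e)) ∧
      (∀ j i, Y j i ∈ phiPart F C ∧ Y j i ∈ parityPart F C (F.par 0 j + F.par 0 i + e)) ∧
      (∀ j i, Y j i = -(sgn (F.par 0 i * F.par 0 j) • Y i j)) ∧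
      ∀ i, E i = ∑ a, R i a * X a + ∑ j, T j * Y j i

theorem superDer_eq_zero_of_mem_phiPart {p : ZMod 2} {v : Gen F → SAlg F C}
    {hv : ∀ x : Gen F, v x ∈ parityPart F C (x.parity + p)} (hθ : ∀ i : OddIx F, v (.theta i) = 0)
    {a : SAlg F C} (ha : a ∈ phiPart F C) : superDer p v hv a = 0 := by
  refine superDer_eq_zero p v hv (P := fun x => x.isAntifield = false) (fun x hx => ?_)
    (wordSpan_mono (fun l hl => by simpa [List.countP_eq_zero] using hl) ha)
  cases x with
  | theta i => exact hθ i
  | af t α => simp [Gen.isAntifield] at hx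

section Acyclic

variable {v : Gen F → SAlg F C} {hv : ∀ x : Gen F, v x ∈ parityPart F C (x.parity + 1)}

theorem superDer_gen_mul_of_mem_phiPart (hθ : ∀ i, v (.theta i) = 0) (x : Gen F) {a : SAlg F C}
    (ha : a ∈ phiPart F C) : superDer 1 v hv (gen F C x * a) = v x * a := by
  rw [superDer_gen_mul, superDer_eq_zero_of_mem_phiPart hθ ha]
  simp

/-- Functions of antifield number two. -/
theorem exists_normalForm_afn_two {e : ZMod 2} {g : SAlg F C} (hg : g ∈ afnPart F C 2)
    (hg' : g ∈ parityPart F C e) :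
    ∃ (X : Fin (F.mult 1) → SAlg F C) (W : Fin (F.mult 0) → Fin (F.mult 0) → SAlg F C),
      (∀ a, X a ∈ phiPart F C ∧ X a ∈ parityPart F C (F.par 1 a + e)) ∧
      (∀ i j, W i j ∈ phiPart F C ∧ W i j ∈ parityPart F C (F.par 0 i + F.par 0 j + e)) ∧
      g = ∑ a, gen F C (.af 1 a) * X a +
        ∑ i, ∑ j, gen F C (.af 0 i) * (gen F C (.af 0 j) * W i j) := by
  let m : Fin (F.mult 1) ⊕ (Fin (F.mult 0) × Fin (F.mult 0)) → List (Gen F) :=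
    Sum.elim (fun a => [.af 1 a]) (fun q => [.af 0 q.1, .af 0 q.2])
  have hP : ∀ l : List (Gen F), (l.map Gen.afn).sum = 2 ∧ (l.map Gen.parity).sum = e →
      (l.map Gen.parity).sum = e ∧ (word F C l ∈ (⊥ : Submodule C (SAlg F C)) ∨
        ∃ i l', l'.countP Gen.isAntifield = 0 ∧ l.Perm (m i ++ l')) := by
    rintro l ⟨hl, hl'⟩
    refine ⟨hl', Or.inr ?_⟩
    obtain ⟨a, l', h, hp⟩ := exists_perm_antifields_append l
    rw [(hp.map _).sum_eq, List.map_append, List.sum_append, sum_afn_eq_zero h, add_zero] at hl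
    -- Antifield number two leaves one stage-zero `c*` or two `φ*`.
    match a with
    | [] => simp at hl
    | [⟨t, α⟩] =>
      obtain rfl : t = 1 := by simp [Gen.afn] at hl; omega
      exact ⟨.inl α, l', h, hp⟩
    | [⟨t, α⟩, ⟨u, β⟩] =>
      obtain rfl : t = 0 := by simp [Gen.afn] at hl; omega
      obtain rfl : u = 0 := by simp [Gen.afn] at hl; omega
      exact ⟨.inr (α, β), l', h, hp⟩
    | ⟨t, α⟩ :: ⟨u, β⟩ :: ⟨w, γ⟩ :: a =>
      have := sum_afn_nonneg (a.map fun y => Gen.af y.1 y.2)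
      simp [Gen.afn] at hl this
      omega
  obtain ⟨N, hN, h⟩ := exists_normalForm m e ⊥ hP
    (mem_wordSpan_and (permInvariant_sum _ (fun n => n = e)) hg hg')
  refine ⟨fun a => N (.inl a), fun i j => N (.inr (i, j)), fun a => ⟨(hN _).1, ?_⟩,
    fun i j => ⟨(hN _).1, ?_⟩, ?_⟩
  · convert (hN (.inl a)).2 using 2
    simp only [m, Sum.elim_inl, List.map_cons, List.map_nil, List.sum_cons, List.sum_nil,
      Gen.parity]
    push_cast
    linear_combination (-1 : ZMod 2) * CharTwo.add_self_eq_zero (1 : ZMod 2)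
  · convert (hN (.inr (i, j))).2 using 2
    simp only [m, Sum.elim_inr, List.map_cons, List.map_nil, List.sum_cons, List.sum_nil,
      Gen.parity]
    push_cast
    linear_combination (-1 : ZMod 2) * CharTwo.add_self_eq_zero (1 : ZMod 2)
  · rw [Submodule.mem_bot, sub_eq_zero] at h
    rw [h, Fintype.sum_sum_type, Fintype.sum_prod_type]
    simp [m, mul_assoc]

/-- Acyclicity at antifield number one. -/
theorem koszulExact_of_acyclic {T : Fin (F.mult 0) → SAlg F C}
    {R : Fin (F.mult 0) → Fin (F.mult 1) → SAlg F C}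
    (hafn : ∀ x, v x ∈ afnPart F C (x.afn - 1)) (hθ : ∀ i, v (.theta i) = 0)
    (hvT : ∀ i, v (.af 0 i) = T i) (hvR : ∀ a, v (.af 1 a) = ∑ i, gen F C (.af 0 i) * R i a)
    (hT : ∀ i, T i ∈ phiPart F C) (hT' : ∀ i, T i ∈ parityPart F C (F.par 0 i))
    (hR : ∀ i a, R i a ∈ phiPart F C)
    (hD : ∀ f ∈ afnPart F C 1, f ∈ cpx F C (-1) → superDer 1 v hv f = 0 →
      ∃ g, superDer 1 v hv g = f) : KoszulExact T R := by
  intro e E hE hTE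
  have hφ : ∀ i, gen F C (.af 0 i) ∈ afnPart F C 1 := fun i => by
    rw [← word_singleton]
    exact word_mem_wordSpan (by simp [Gen.afn])
  have hf : ∑ i, gen F C (.af 0 i) * E i ∈ afnPart F C 1 := Submodule.sum_mem _ fun i _ =>
    mul_mem_wordSpan (fun l l' h h' => by simp [h, sum_afn_eq_zero h']) (hφ i) (hE i).1
  have hf' : ∑ i, gen F C (.af 0 i) * E i ∈ parityPart F C (e + 1) :=
    Submodule.sum_mem _ fun i _ => by
      convert mul_mem_parityPart (gen_mem_parityPart (.af 0 i)) (hE i).2 using 2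
      simp only [Gen.parity]
      push_cast
      linear_combination -CharTwo.add_self_eq_zero (F.par 0 i)
  have hDf : superDer 1 v hv (∑ i, gen F C (.af 0 i) * E i) = 0 := by
    rw [map_sum, ← hTE]
    exact Finset.sum_congr rfl fun i _ => by
      rw [superDer_gen_mul_of_mem_phiPart hθ _ (hE i).1, hvT]
  obtain ⟨g, hg⟩ := hD _ hf (mem_cpx_of_mem_afnPart (by simp) hf) hDf
  -- A preimage need not be homogeneous; its part of antifield number two and parity `e` is again a
  -- preimage.
  have hg' := superDer_proj (hv := hv) (f := Gen.bidegree) (m := (-1, 1)) (w := (2, e))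
    (fun x => mem_bidegree_iff.2 ⟨hafn x, hv x⟩) (mem_bidegree_iff.2 ⟨hf, hf'⟩) hg
  obtain ⟨hg2, hge⟩ := mem_bidegree_iff.1 (wordSpan_mono (fun _ h => h.2) (proj_mem
    (permInvariant_sum Gen.bidegree (fun n => n = (2, e))) (mem_wordSpan_true g)))
  obtain ⟨X, W, hX, hW, hgXW⟩ := exists_normalForm_afn_two hg2 hge
  rw [hgXW] at hg'
  -- The coefficient of `φ*_i T_j` in the image of `∑ φ* φ* W`. The first term arises when the
  -- derivation hits the left `φ*` and `T_j` is moved past `φ*_i`, the second when it hits the right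
  -- one. The sum is graded antisymmetric for any `W`.
  let Y : Fin (F.mult 0) → Fin (F.mult 0) → SAlg F C := fun j i =>
    sgn (F.par 0 j * (F.par 0 i + 1)) • W j i + sgn (F.par 0 i + 1) • W i j
  have hDX : superDer 1 v hv (∑ a, gen F C (.af 1 a) * X a) =
      ∑ i, gen F C (.af 0 i) * ∑ a, R i a * X a := by
    simp only [map_sum, Finset.mul_sum]
    rw [Finset.sum_comm]
    refine Finset.sum_congr rfl fun a _ => ?_
    rw [superDer_gen_mul_of_mem_phiPart hθ _ (hX a).1, hvR, Finset.sum_mul]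
    exact Finset.sum_congr rfl fun i _ => mul_assoc _ _ _
  have hDW : superDer 1 v hv (∑ i, ∑ j, gen F C (.af 0 i) * (gen F C (.af 0 j) * W i j)) =
      ∑ i, gen F C (.af 0 i) * ∑ j, T j * Y j i := by
    have h : ∀ i j, superDer 1 v hv (gen F C (.af 0 i) * (gen F C (.af 0 j) * W i j)) =
        gen F C (.af 0 j) * (T i * (sgn (F.par 0 i * (F.par 0 j + 1)) • W i j)) +
        gen F C (.af 0 i) * (T j * (sgn (F.par 0 i + 1) • W i j)) := fun i j => by
      rw [superDer_gen_mul, superDer_gen_mul_of_mem_phiPart hθ _ (hW i j).1, hvT, hvT, ← mul_assoc,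
        mul_comm_of_mem_parityPart (hT' i) (gen_mem_parityPart (.af 0 j))]
      simp only [Gen.parity, Nat.cast_zero, add_zero, one_mul, mul_smul_comm, smul_mul_assoc,
        mul_assoc]
    simp only [map_sum, h, Finset.sum_add_distrib, Y, mul_add, Finset.mul_sum]
    rw [Finset.sum_comm]
  rw [map_add, hDX, hDW] at hg'
  refine ⟨X, Y, hX, fun j i => ⟨?_, ?_⟩, fun j i => ?_, fun i => ?_⟩
  · exact Submodule.add_mem _ (zsmul_mem_wordSpan _ (hW j i).1) (zsmul_mem_wordSpan _ (hW i j).1)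
  · exact Submodule.add_mem _ (zsmul_mem_wordSpan _ (hW j i).2)
      (zsmul_mem_wordSpan _ (add_comm (F.par 0 j) (F.par 0 i) ▸ (hW i j).2))
  · have h1 : ∀ a b : ZMod 2, sgn (a + 1) = -(sgn (a * b) * sgn (a * (b + 1))) := by decide
    have h2 : ∀ a b : ZMod 2, sgn (b * (a + 1)) = -(sgn (a * b) * sgn (b + 1)) := by decide
    simp only [Y]
    rw [zsmul_add, smul_smul, smul_smul, neg_add, ← neg_smul, ← neg_smul, ← h1, ← h2, add_comm]
  · have h0 : ∑ i, gen F C (.af 0 i) * (E i - (∑ a, R i a * X a + ∑ j, T j * Y j i)) = 0 := by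
      simp only [mul_sub, mul_add, Finset.sum_sub_distrib, Finset.sum_add_distrib]
      rw [hg', sub_self]
    refine sub_eq_zero.1 (eq_zero_of_sum_mul_mem_orderAf (t := 0) (fun i => ?_)
      (h0.symm ▸ Submodule.zero_mem _) i)
    refine Submodule.sub_mem _ (hE i).1 (Submodule.add_mem _ (Submodule.sum_mem _ fun a _ =>
      mul_mem_phiPart (hR i a) (hX a).1) (Submodule.sum_mem _ fun j _ => mul_mem_phiPart (hT j)
        (Submodule.add_mem _ (zsmul_mem_wordSpan _ (hW j i).1)
          (zsmul_mem_wordSpan _ (hW i j).1))))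

end Acyclic

/-- The trivial relations solve `∑ T E = 0` for multiples of elements of the ideal of `T`. -/
theorem exists_antisymm_of_sum_mul_eq {T h E : Fin (F.mult 0) → SAlg F C} {e : ZMod 2} {u : C}
    (hT : ∀ i, T i ∈ parityPart F C (F.par 0 i))
    (hh : ∀ i, h i ∈ phiPart F C ∧ h i ∈ parityPart F C (F.par 0 i))
    (hE : ∀ i, E i ∈ phiPart F C ∧ E i ∈ parityPart F C (F.par 0 i + e))
    (hTE : ∑ i, T i * E i = 0) (hTh : ∑ i, T i * h i = algebraMap _ _ u) :
    ∃ Y : Fin (F.mult 0) → Fin (F.mult 0) → SAlg F C,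
      (∀ j i, Y j i ∈ phiPart F C ∧ Y j i ∈ parityPart F C (F.par 0 j + F.par 0 i + e)) ∧
      (∀ j i, Y j i = -(sgn (F.par 0 i * F.par 0 j) • Y i j)) ∧
      ∀ i, u • E i = ∑ j, T j * Y j i := by
  -- Contraction with `T_j` turns the first term into `u • E i`; the second becomes `h i * ∑ T_j
  -- E_j`, which vanishes.
  refine ⟨fun j i => h j * E i - sgn (F.par 0 j * F.par 0 i) • (h i * E j), fun j i => ⟨?_, ?_⟩,
    fun j i => ?_, fun i => ?_⟩
  · exact Submodule.sub_mem _ (mul_mem_phiPart (hh j).1 (hE i).1)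
      (zsmul_mem_wordSpan _ (mul_mem_phiPart (hh i).1 (hE j).1))
  · refine Submodule.sub_mem _ ?_ (zsmul_mem_wordSpan _ ?_)
    · rw [add_assoc]
      exact mul_mem_parityPart (hh j).2 (hE i).2
    · rw [add_comm (F.par 0 j), add_assoc]
      exact mul_mem_parityPart (hh i).2 (hE j).2
  · beta_reduce
    rw [zsmul_sub, smul_smul, mul_comm (F.par 0 j), sgn_mul_self, one_smul, neg_sub]
  · have h1 : ∀ j, T j * (sgn (F.par 0 j * F.par 0 i) • (h i * E j)) = h i * (T j * E j) :=
      fun j => by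
        rw [mul_smul_comm, ← mul_assoc, mul_comm_of_mem_parityPart (hT j) (hh i).2,
          smul_mul_assoc, smul_smul, sgn_mul_self, one_smul, mul_assoc]
    simp only [mul_sub, h1, Finset.sum_sub_distrib]
    rw [← Finset.mul_sum, hTE, mul_zero, sub_zero, Algebra.smul_def, ← hTh, Finset.sum_mul]
    exact Finset.sum_congr rfl fun j _ => mul_assoc _ _ _

end SuperAlgebra

/-! ### Localisation of exactness near the stationary surface -/

section Localization

variable {Ω U V : Opens (Base F)}

theorem Alg.res_zsmul (hV : V ≤ U) (n : ℤ) (a : Alg U) :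
    Alg.res hV (n • a) = n • Alg.res hV a := map_zsmul _ _ _

/-- Exactness over `U` implies exactness over any smaller neighbourhood of the stationary
surface. -/
theorem KoszulExact.res {S₀ : SuperFn Ω} (hS₀ : S₀.IsEven) (hU : U ≤ Ω) (hV : V ≤ U)
    (hS : S₀.stationarySurface ⊆ (V : Set (Base F)))
    {R : Fin (F.mult 0) → Fin (F.mult 1) → Alg U}
    (hT : ∀ i, S₀.eom hU i ∈ parityPart F (Smooth F U) (F.par 0 i))
    (hex : KoszulExact (S₀.eom hU) R) :
    KoszulExact (S₀.eom (hV.trans hU)) fun i a => Alg.res hV (R i a) := by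
  intro e E hE hTE
  obtain ⟨χ, η, hχ, hη⟩ := S₀.exists_cutoff hU hV hS
  obtain ⟨ext, hext, hres⟩ := Smooth.exists_extension hV χ hχ
  obtain ⟨tr, htr⟩ := SAlg.exists_transfer (F := F) (Smooth.res F hV) ext hext
  have hTV : ∀ i, S₀.eom (hV.trans hU) i ∈ parityPart F (Smooth F V) (F.par 0 i) := fun i => by
    rw [← Alg.res_eom hU hV]
    exact SAlg.map_mem _ (hT i)
  obtain ⟨N, h, hh, hTh⟩ := SuperFn.exists_sum_eom_mul_eq hS₀ (hV.trans hU) hTV hη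
  set ρ : Smooth F V := 1 - Smooth.res F hV χ with hρ
  -- Nilpotents only give `ρ ^ N`, not `ρ`, as an element of the ideal. The factor `σ` completes `χ
  -- = 1 - ρ` to `χ σ = 1 - ρ ^ N`.
  let σ : Smooth F V := ∑ k ∈ Finset.range N, ρ ^ k
  have hσ : Smooth.res F hV χ * σ = 1 - ρ ^ N := by
    rw [← mul_neg_geom_sum ρ N, hρ, sub_sub_cancel]
  -- Exactness over `U` is applied to the extension by zero of `χ σ E`, which is still a syzygy.
  obtain ⟨X, Y, hX, hY, hYanti, hXY⟩ := hex e (fun i => tr (σ • E i))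
    (fun i => ⟨SAlg.transfer_mem htr (Submodule.smul_mem _ _ (hE i).1),
      SAlg.transfer_mem htr (Submodule.smul_mem _ _ (hE i).2)⟩) (by
      have : ∀ i, S₀.eom hU i * tr (σ • E i) = tr (S₀.eom (hV.trans hU) i * (σ • E i)) :=
        fun i => by
          rw [← SAlg.transfer_map_mul htr hext, ← Alg.res_eom hU hV]
          rfl
      simp only [this, ← map_sum, mul_smul_comm, ← Finset.smul_sum, hTE]
      simp)
  obtain ⟨Y', hY', hYanti', hXY'⟩ := exists_antisymm_of_sum_mul_eq hTV hh hE hTE hTh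
  refine ⟨fun a => Alg.res hV (X a), fun j i => Alg.res hV (Y j i) + Y' j i,
    fun a => ⟨SAlg.map_mem _ (hX a).1, SAlg.map_mem _ (hX a).2⟩,
    fun j i => ⟨Submodule.add_mem _ (SAlg.map_mem _ (hY j i).1) (hY' j i).1,
      Submodule.add_mem _ (SAlg.map_mem _ (hY j i).2) (hY' j i).2⟩, fun j i => ?_, fun i => ?_⟩
  · beta_reduce
    rw [zsmul_add, neg_add, ← hYanti' j i, hYanti j i, map_neg, Alg.res_zsmul]
  · have h1 : Alg.res hV (tr (σ • E i)) = (1 - ρ ^ N) • E i := by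
      rw [← hσ, mul_smul]
      exact SAlg.map_transfer htr hres _
    -- The partition of unity `(1 - ρ ^ N) + ρ ^ N` splits `E` into the part solved over `U` and a
    -- part in which only trivial relations occur.
    have h2 : E i = Alg.res hV (tr (σ • E i)) + ρ ^ N • E i := by
      rw [h1, ← add_smul, sub_add_cancel, one_smul]
    rw [h2, hXY, hXY']
    simp only [map_add, map_sum, map_mul, Alg.res_eom, mul_add, Finset.sum_add_distrib]
    abel

end Localization

end KoszulTate

namespace KoszulTate

variable {F : FieldContent}

section SuperAlgebra

variable {C : Type} [CommRing C]

/-! ### Uniqueness and nilpotency of superderivations -/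

theorem superDer_congr {p : ZMod 2} {v v' : Gen F → SAlg F C}
    {hv : ∀ x : Gen F, v x ∈ parityPart F C (x.parity + p)}
    {hv' : ∀ x : Gen F, v' x ∈ parityPart F C (x.parity + p)} {P : Gen F → Prop}
    (h : ∀ x, P x → v x = v' x) {a : SAlg F C} (ha : a ∈ wordSpan F C fun l => ∀ x ∈ l, P x) :
    superDer p v hv a = superDer p v' hv' a := by
  have : wordSpan F C (fun l => ∀ x ∈ l, P x) ≤
      LinearMap.eqLocus (superDer p v hv) (superDer p v' hv') := by
    refine wordSpan_le.2 fun l hl => ?_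
    rw [LinearMap.mem_eqLocus]
    induction l with
    | nil => simp
    | cons x l ih =>
      rw [word_cons, superDer_gen_mul, superDer_gen_mul, h x (hl x (by simp)),
        ih fun y hy => hl y (by simp [hy])]
  exact this ha

/-- The square of an odd derivation is a derivation: in a product the mixed terms cancel because `v
x` and `x` have opposite parities. Hence it suffices that the square vanishes on generators. -/
theorem superDer_superDer_eq_zero {v : Gen F → SAlg F C}
    {hv : ∀ x : Gen F, v x ∈ parityPart F C (x.parity + 1)} {P : Gen F → Prop}
    (h : ∀ x, P x → superDer 1 v hv (v x) = 0) {a : SAlg F C}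
    (ha : a ∈ wordSpan F C fun l => ∀ x ∈ l, P x) :
    superDer 1 v hv (superDer 1 v hv a) = 0 := by
  have : wordSpan F C (fun l => ∀ x ∈ l, P x) ≤
      LinearMap.ker (superDer 1 v hv ∘ₗ superDer 1 v hv) := by
    refine wordSpan_le.2 fun l hl => ?_
    rw [LinearMap.mem_ker, LinearMap.comp_apply]
    induction l with
    | nil => simp
    | cons x l ih =>
      have hs : sgn (1 * (x.parity + 1)) = -sgn (1 * x.parity) := by
        generalize x.parity = e
        revert e; decide
      rw [word_cons, superDer_gen_mul, map_add, map_zsmul, superDer_gen_mul,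
        superDer_mul_of_mem 1 v hv (hv x), h x (hl x (by simp)),
        ih fun y hy => hl y (by simp [hy]), hs, zero_mul, zero_add, mul_zero, zsmul_zero, add_zero,
        neg_smul, neg_add_cancel]
  exact this ha

theorem superDer_mem_cpx {p : ZMod 2} {v : Gen F → SAlg F C}
    {hv : ∀ x : Gen F, v x ∈ parityPart F C (x.parity + p)} {k : ℤ}
    (h : ∀ x, x.InCpx k → v x ∈ cpx F C k) {a : SAlg F C} (ha : a ∈ cpx F C k) :
    superDer p v hv a ∈ cpx F C k := by
  refine superDer_mem (S := (cpx F C k).toSubmodule) p v hv (fun l₁ x l₂ hl => ?_)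
    (mem_cpx_iff.1 ha)
  exact (cpx F C k).mul_mem ((cpx F C k).mul_mem (word_mem_cpx fun y hy => hl y (by simp [hy]))
    (h x (hl x (by simp)))) (word_mem_cpx fun y hy => hl y (by simp [hy]))

/-- Antifield number of a product with a function of the fields. -/
theorem mul_mem_afnPart {a b : SAlg F C} {j k : ℤ} (ha : a ∈ afnPart F C j)
    (hb : b ∈ afnPart F C k) : a * b ∈ afnPart F C (j + k) :=
  mul_mem_wordSpan (by rintro l l' rfl rfl; simp) ha hb

theorem mem_afnPart_of_mem_phiPart {a : SAlg F C} (ha : a ∈ phiPart F C) : a ∈ afnPart F C 0 :=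
  wordSpan_mono (fun _ => sum_afn_eq_zero) ha

theorem gen_mem_afnPart (x : Gen F) : gen F C x ∈ afnPart F C x.afn := by
  rw [← word_singleton]
  exact word_mem_wordSpan (by simp)

theorem mul_mem_orderAf {a b : SAlg F C} {m n : ℕ} (ha : a ∈ orderAf F C m)
    (hb : b ∈ orderAf F C n) : a * b ∈ orderAf F C (m + n) :=
  mul_mem_wordSpan (fun l l' h h' => by rw [List.countP_append]; omega) ha hb

theorem mem_orderAf_zero (a : SAlg F C) : a ∈ orderAf F C 0 :=
  wordSpan_mono (fun _ _ => Nat.zero_le _) (mem_wordSpan_true a)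

theorem mem_orderAf_one {a : SAlg F C} {j : ℤ} (hj : j ≠ 0) (ha : a ∈ afnPart F C j) :
    a ∈ orderAf F C 1 :=
  wordSpan_mono (fun l hl => by
    by_contra h
    exact hj (hl ▸ sum_afn_eq_zero (by omega))) ha

theorem gen_af_mem_orderAf (t : ℕ) (α : Fin (F.mult t)) : gen F C (.af t α) ∈ orderAf F C 1 := by
  rw [← word_singleton]
  exact word_mem_wordSpan (by simp [Gen.isAntifield])

theorem afn_bilinear_mem {t : ℕ} (α : Fin (F.mult t)) {N : Fin (F.mult 0) → SAlg F C}
    (hN : ∀ i, N i ∈ phiPart F C) :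
    gen F C (.af t α) * ∑ i, gen F C (.af 0 i) * N i ∈ afnPart F C (t + 2) := by
  rw [Finset.mul_sum]
  refine Submodule.sum_mem _ fun i _ => ?_
  have := mul_mem_afnPart (gen_mem_afnPart (C := C) (.af t α)) (mul_mem_afnPart
    (gen_mem_afnPart (.af 0 i)) (mem_afnPart_of_mem_phiPart (hN i)))
  convert this using 2
  simp only [Gen.afn]
  push_cast
  ring

/-- The action of a superderivation on terms `c* φ* N`. -/
theorem superDer_bilinear {v : Gen F → SAlg F C}
    {hv : ∀ x : Gen F, v x ∈ parityPart F C (x.parity + 1)} (hθ : ∀ i, v (.theta i) = 0) {t : ℕ}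
    (α : Fin (F.mult t)) {N : Fin (F.mult 0) → SAlg F C} (hN : ∀ i, N i ∈ phiPart F C) :
    superDer 1 v hv (gen F C (.af t α) * ∑ i, gen F C (.af 0 i) * N i) =
      v (.af t α) * ∑ i, gen F C (.af 0 i) * N i +
        sgn (Gen.af t α).parity • (gen F C (.af t α) * ∑ i, v (.af 0 i) * N i) := by
  rw [superDer_gen_mul, one_mul, map_sum]
  simp only [superDer_gen_mul_of_mem_phiPart hθ _ (hN _)]

end SuperAlgebra

/-! ### Koszul-Tate operators as superderivations -/

section Operators

variable {Ω U V : Opens (Base F)} {S₀ : SuperFn Ω} {hU : U ≤ Ω} {Z : Generators U} {k : ℤ}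
  {s : Op U k}

open Classical in
/-- The values of an operator on the generators, extended by zero. -/
noncomputable def Op.value (s : Op U k) (x : Gen F) : Alg U :=
  if h : x.InCpx k then (s ⟨gen F _ x, gen_mem_cpx h⟩ : Alg U) else 0

theorem Op.value_of_inCpx {x : Gen F} (h : x.InCpx k) :
    s.value x = s ⟨gen F _ x, gen_mem_cpx h⟩ := dif_pos h

theorem Op.value_mem {x : Gen F} {S : Submodule (Smooth F U) (Alg U)}
    (h : ∀ h : x.InCpx k, (s ⟨gen F _ x, gen_mem_cpx h⟩ : Alg U) ∈ S) : s.value x ∈ S := by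
  by_cases hx : x.InCpx k
  · rw [Op.value_of_inCpx hx]
    exact h hx
  · rw [Op.value, dif_neg hx]
    exact S.zero_mem

namespace IsKoszulTate

theorem value_mem_parityPart (hs : IsKoszulTate S₀ hU Z k s) (x : Gen F) :
    s.value x ∈ parityPart F (Smooth F U) (x.parity + 1) :=
  Op.value_mem fun _ => hs.odd _ _ (gen_mem_parityPart x)

theorem value_mem_afnPart (hs : IsKoszulTate S₀ hU Z k s) (x : Gen F) :
    s.value x ∈ afnPart F (Smooth F U) (x.afn - 1) :=
  Op.value_mem fun _ => hs.afn _ _ (gen_mem_afnPart x)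

theorem value_mem_cpx (x : Gen F) : s.value x ∈ cpx F (Smooth F U) k :=
  Op.value_mem (S := (cpx F (Smooth F U) k).toSubmodule) fun _ => Subtype.property _

theorem value_theta (hs : IsKoszulTate S₀ hU Z k s) (i : OddIx F) : s.value (.theta i) = 0 := by
  rw [Op.value_of_inCpx (show (Gen.theta i : Gen F).InCpx k from trivial)]
  exact congrArg Subtype.val (hs.theta i)

theorem value_original (hs : IsKoszulTate S₀ hU Z k s) (hk : -1 ≤ k) (i : Fin (F.mult 0)) :
    s.value (.af 0 i) = S₀.eom hU i := by
  have h : ((0 : ℕ) : ℤ) - 1 ≤ k := by simpa using hk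
  rw [Op.value_of_inCpx (x := .af 0 i) h]
  exact hs.original h i

theorem value_stageZero (hs : IsKoszulTate S₀ hU Z k s) (hk : 0 ≤ k) (α : Fin (F.mult 1)) :
    s.value (.af 1 α) = ∑ i, Φs U 0 i * Z 0 i α := by
  have h : ((1 : ℕ) : ℤ) - 1 ≤ k := by simpa using hk
  rw [Op.value_of_inCpx (x := .af 1 α) h]
  exact hs.stageZero h α

theorem value_higherStage (hs : IsKoszulTate S₀ hU Z k s) {t : ℕ} (hk : (t : ℤ) ≤ k) (ht : 1 ≤ t)
    (α : Fin (F.mult (t + 1))) :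
    s.value (.af (t + 1) α) - ∑ β, Φs U t β * Z t β α ∈ orderAf F (Smooth F U) 2 := by
  have h : ((t + 1 : ℕ) : ℤ) - 1 ≤ k := by push_cast; omega
  rw [Op.value_of_inCpx (x := .af (t + 1) α) h]
  exact hs.higherStage t h α ht

/-- The superderivation of the algebra of all functions that a Koszul-Tate operator defines. -/
noncomputable def der (hs : IsKoszulTate S₀ hU Z k s) : Alg U →ₗ[Smooth F U] Alg U :=
  superDer 1 s.value hs.value_mem_parityPart

/-- The Leibniz rule determines an operator by its values on generators. It is thus the restriction
of a superderivation of the whole algebra, where calculations need no membership proofs. -/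
theorem coe_apply (hs : IsKoszulTate S₀ hU Z k s) (a : cpx F (Smooth F U) k) :
    (s a : Alg U) = hs.der a := by
  have hword : ∀ (l : List (Gen F)) (hl : ∀ x ∈ l, x.InCpx k),
      (s ⟨word F _ l, word_mem_cpx hl⟩ : Alg U) = hs.der (word F _ l) := by
    intro l
    induction l with
    | nil =>
      intro _
      have h1 := hs.leibniz 0 1 1 one_mem_parityPart
      have h2 : s 1 = 0 := by
        have h2 : s (1 * 1) = s 1 * 1 + 1 * s 1 := h1.trans (congrArg _ (Subtype.ext (one_zsmul _)))
        simpa using h2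
      have h3 : (s 1 : Alg U) = 0 := congrArg Subtype.val h2
      exact h3.trans (superDer_one _ _ _).symm
    | cons x l ih =>
      intro hl
      have hx := hl x (by simp)
      have hl' : ∀ y ∈ l, y.InCpx k := fun y hy => hl y (by simp [hy])
      have h := congrArg Subtype.val (hs.leibniz _ ⟨gen F _ x, gen_mem_cpx hx⟩
        ⟨word F _ l, word_mem_cpx hl'⟩ (gen_mem_parityPart x))
      have h' : (s ⟨word F _ (x :: l), word_mem_cpx hl⟩ : Alg U) = s.value x * word F _ l +
          sgn x.parity • (gen F _ x * (s ⟨word F _ l, word_mem_cpx hl'⟩ : Alg U)) := by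
        rw [Op.value_of_inCpx hx]
        refine Eq.trans ?_ (h.trans ?_)
        · congr 3
        · exact congrArg₂ (· + ·) rfl (AddSubgroupClass.coe_zsmul _ _)
      rw [h', ih hl', word_cons, der, superDer_gen_mul, one_mul]
  have : ∀ b ∈ wordSpan F (Smooth F U) (fun l => ∀ x ∈ l, x.InCpx k),
      ∀ hb : b ∈ cpx F (Smooth F U) k, (s ⟨b, hb⟩ : Alg U) = hs.der b := by
    intro b hb
    induction hb using Submodule.span_induction with
    | mem b hb =>
      obtain ⟨l, hl, rfl⟩ := hb
      exact fun _ => hword l hl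
    | zero =>
      intro h
      rw [map_zero]
      exact congrArg Subtype.val (map_zero s)
    | add b c hb hc ihb ihc =>
      intro h
      rw [map_add, ← ihb (mem_cpx_iff.2 hb), ← ihc (mem_cpx_iff.2 hc)]
      exact congrArg Subtype.val (map_add s ⟨b, mem_cpx_iff.2 hb⟩ ⟨c, mem_cpx_iff.2 hc⟩)
    | smul c b hb ihb =>
      intro h
      rw [map_smul, ← ihb (mem_cpx_iff.2 hb)]
      exact congrArg Subtype.val (map_smul s c ⟨b, mem_cpx_iff.2 hb⟩)
  exact this a (mem_cpx_iff.1 a.2) a.2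

theorem der_der (hs : IsKoszulTate S₀ hU Z k s) (hnil : IsNilpotentOp s) {a : Alg U}
    (ha : a ∈ cpx F (Smooth F U) k) : hs.der (hs.der a) = 0 := by
  have h := congrArg Subtype.val (hnil ⟨a, ha⟩)
  rw [hs.coe_apply, hs.coe_apply] at h
  exact h

theorem exists_der_eq (hs : IsKoszulTate S₀ hU Z k s) {j : ℤ} (hjk : j ≤ k)
    (hacyc : IsAcyclicOn s j) {p : ℤ} (hp : 0 < p) {f : Alg U}
    (hf : f ∈ afnPart F (Smooth F U) p) (hf' : f ∈ cpx F (Smooth F U) j) (h0 : hs.der f = 0) :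
    ∃ g ∈ cpx F (Smooth F U) (j + 1), hs.der g = f := by
  obtain ⟨g, hg, h⟩ := hacyc p ⟨f, cpx_mono hjk hf'⟩ hp hf hf'
    (Subtype.ext (by rw [hs.coe_apply]; exact h0))
  refine ⟨g, hg, ?_⟩
  rw [← hs.coe_apply, h]

theorem eom_mem_parityPart (hs : IsKoszulTate S₀ hU Z k s) (hk : -1 ≤ k) (i : Fin (F.mult 0)) :
    S₀.eom hU i ∈ parityPart F (Smooth F U) (F.par 0 i) := by
  rw [← hs.value_original hk]
  convert hs.value_mem_parityPart (.af 0 i) using 2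
  simp only [Gen.parity]
  push_cast
  linear_combination -CharTwo.add_self_eq_zero (1 : ZMod 2)

/-- As `j ≥ -1`, acyclicity on the `j`th complex covers the functions `φ*_i E^i` of antifield number
one, whose closedness is the relation `∑ T_i E^i = 0`. -/
theorem koszulExact (hs : IsKoszulTate S₀ hU Z k s) {j : ℤ} (hj : -1 ≤ j) (hk : 0 ≤ k)
    (hjk : j ≤ k) (hacyc : IsAcyclicOn s j) (hZ : ∀ i a, Z 0 i a ∈ phiPart F (Smooth F U)) :
    KoszulExact (S₀.eom hU) (Z 0) :=
  koszulExact_of_acyclic hs.value_mem_afnPart hs.value_theta (hs.value_original (by omega))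
    (hs.value_stageZero hk) (fun _ => SuperFn.toAlg_mem_phiPart _ _)
    (hs.eom_mem_parityPart (by omega)) hZ fun _ hf hf' h0 => by
      obtain ⟨g, -, hg⟩ := hs.exists_der_eq hjk hacyc one_pos hf (cpx_mono hj hf') h0
      exact ⟨g, hg⟩

end IsKoszulTate

theorem Alg.res_refl (a : Alg U) : Alg.res (le_refl U) a = a := by
  refine wordSpan_induction (Q := fun a => Alg.res (le_refl U) a = a) (map_zero _)
    (fun a b ha hb => by rw [map_add, ha, hb]) (fun c l _ => ?_) (mem_wordSpan_true a)
  rw [Alg.res, SAlg.map_smul, SAlg.map_word]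
  rfl

end Operators

end KoszulTate

namespace KoszulTate

variable {F : FieldContent}

/-! ### Existence of the extension -/

section Existence

variable {Ω U : Opens (Base F)} {S₀ : SuperFn Ω} {hU : U ≤ Ω} {Z : Generators U}

theorem parity_linear_mem {t : ℕ} (β : Fin (F.mult (t + 1))) {γ : Fin (F.mult (t + 2))} {f : Alg U}
    (hf : IsStructureFn (F.par (t + 1) β + F.par (t + 2) γ) f) :
    Φs U (t + 1) β * f ∈ parityPart F (Smooth F U) (F.par (t + 2) γ + t) := by
  convert mul_mem_parityPart (gen_mem_parityPart (.af (t + 1) β)) hf.2 using 2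
  simp only [Gen.parity]
  push_cast
  linear_combination -CharTwo.add_self_eq_zero (F.par (t + 1) β) -
    CharTwo.add_self_eq_zero (1 : ZMod 2)

theorem parity_bilinear_mem {t : ℕ} (α : Fin (F.mult t)) {γ : Fin (F.mult (t + 2))}
    {N : Fin (F.mult 0) → Alg U}
    (hN : ∀ i, IsStructureFn (F.par 0 i + F.par t α + F.par (t + 2) γ) (N i)) :
    Φs U t α * ∑ i, Φs U 0 i * N i ∈ parityPart F (Smooth F U) (F.par (t + 2) γ + t) := by
  rw [Finset.mul_sum]
  refine Submodule.sum_mem _ fun i _ => ?_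
  convert mul_mem_parityPart (gen_mem_parityPart (.af t α))
    (mul_mem_parityPart (gen_mem_parityPart (.af 0 i)) (hN i).2) using 2
  simp only [Gen.parity]
  push_cast
  linear_combination -CharTwo.add_self_eq_zero (F.par t α) -
    CharTwo.add_self_eq_zero (F.par 0 i) - CharTwo.add_self_eq_zero (1 : ZMod 2)

theorem afn_linear_mem {t : ℕ} (α : Fin (F.mult t)) {f : Alg U}
    (hf : f ∈ phiPart F (Smooth F U)) : Φs U t α * f ∈ afnPart F (Smooth F U) (t + 1) := by
  convert mul_mem_afnPart (gen_mem_afnPart (.af t α)) (mem_afnPart_of_mem_phiPart hf) using 2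
  simp only [Gen.afn]
  ring

/-- Terms of low stage and high antifield number contain two antifields. -/
theorem mem_orderAf_two_of_mem_cpx {r : ℕ} {a : Alg U}
    (ha : a ∈ cpx F (Smooth F U) ((r : ℤ) - 1)) (ha' : a ∈ afnPart F (Smooth F U) (r + 2)) :
    a ∈ orderAf F (Smooth F U) 2 := by
  refine wordSpan_mono (fun l hl => ?_) (mem_wordSpan_and
    (permInvariant_sum Gen.afn (fun n => n = (r : ℤ) + 2)) (mem_cpx_iff.1 ha) ha')
  obtain ⟨hl, hafn⟩ := hl
  obtain ⟨a, l', h, hp⟩ := exists_perm_antifields_append l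
  rw [(hp.map _).sum_eq, List.map_append, List.sum_append, sum_afn_eq_zero h, add_zero] at hafn
  rw [hp.countP_eq, List.countP_append]
  -- A single antifield of antifield number `r + 2` has stage `r`, beyond the bound `r - 1`.
  match a with
  | [] =>
    simp at hafn
    omega
  | [⟨t, α⟩] =>
    have := hl (.af t α) (hp.mem_iff.2 (by simp))
    simp [Gen.afn, Gen.InCpx] at hafn this
    omega
  | ⟨t, α⟩ :: ⟨u, β⟩ :: a =>
    simp only [List.map_cons, List.countP_cons, Gen.isAntifield, if_true]
    omega

/-- Terms with two antifields only contain antifields of low stage. -/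
theorem mem_cpx_of_mem_orderAf_two {r : ℕ} {a : Alg U}
    (ha : a ∈ orderAf F (Smooth F U) 2) (ha' : a ∈ afnPart F (Smooth F U) (r + 1)) :
    a ∈ cpx F (Smooth F U) ((r : ℤ) - 2) := by
  refine mem_cpx_iff.2 (wordSpan_mono (fun l hl x hx => ?_) (mem_wordSpan_and
    (permInvariant_countP _ (fun n => 2 ≤ n)) ha' ha))
  have := afn_add_countP_le hx
  cases x with
  | theta i => trivial
  | af t α =>
    simp only [Gen.InCpx, Gen.afn] at this ⊢
    omega

section

variable {r : ℕ} {s : Op U (r : ℤ)} {γ : Fin (F.mult (r + 2))}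

/-- The part of `D c*_{α_r}` linear in the `c*` produces the product `Z Z`, which the Noether
identity makes proportional to the field equations. -/
theorem IsKoszulTate.der_linear (hs : IsKoszulTate S₀ hU Z r s)
    (hZ : ∀ β, Z (r + 1) β γ ∈ phiPart F (Smooth F U))
    {B : Fin (F.mult 0) → Fin (F.mult r) → Alg U}
    (hNoether : ∀ α, ∑ β, Z r α β * Z (r + 1) β γ = ∑ i, S₀.eom hU i * B i α) :
    hs.der (∑ β, Φs U (r + 1) β * Z (r + 1) β γ) =
      ∑ β, (s.value (.af (r + 1) β) - ∑ α, Φs U r α * Z r α β) * Z (r + 1) β γ +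
      ∑ α, Φs U r α * ∑ i, S₀.eom hU i * B i α := by
  have h1 : hs.der (∑ β, Φs U (r + 1) β * Z (r + 1) β γ) =
      ∑ β, s.value (.af (r + 1) β) * Z (r + 1) β γ := by
    rw [map_sum]
    exact Finset.sum_congr rfl fun β _ =>
      superDer_gen_mul_of_mem_phiPart hs.value_theta _ (hZ β)
  have h2 : ∑ β, (∑ α, Φs U r α * Z r α β) * Z (r + 1) β γ =
      ∑ α, Φs U r α * ∑ i, S₀.eom hU i * B i α := by
    simp only [← hNoether, Finset.sum_mul, Finset.mul_sum, mul_assoc]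
    exact Finset.sum_comm
  rw [h1, ← h2, ← Finset.sum_add_distrib]
  refine Finset.sum_congr rfl fun β _ => ?_
  rw [← add_mul, sub_add_cancel]

/-- The sign compensates the one from moving the odd operator past `c*_{α_{r-1}}`, so that the term
with `T B` is exactly the one in `der_linear`. -/
theorem IsKoszulTate.der_bilinear (hs : IsKoszulTate S₀ hU Z r s)
    {B : Fin (F.mult 0) → Fin (F.mult r) → Alg U}
    (hB : ∀ i α, B i α ∈ phiPart F (Smooth F U)) :
    hs.der (∑ α, sgn (Gen.af r α).parity • (Φs U r α * ∑ i, Φs U 0 i * B i α)) =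
      ∑ α, sgn (Gen.af r α).parity • (s.value (.af r α) * ∑ i, Φs U 0 i * B i α) +
      ∑ α, Φs U r α * ∑ i, S₀.eom hU i * B i α := by
  rw [map_sum, ← Finset.sum_add_distrib]
  refine Finset.sum_congr rfl fun α _ => ?_
  rw [map_zsmul, IsKoszulTate.der, superDer_bilinear hs.value_theta α fun i => hB i α, zsmul_add,
    smul_smul, sgn_mul_self, one_smul]
  simp only [hs.value_original (show (-1 : ℤ) ≤ r by omega)]

/-- A first approximation to the value of the extended operator on a new antifield. -/
theorem IsKoszulTate.exists_approx (hr : 1 ≤ r)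
    (hZ : ∀ t ≤ r + 1, ∀ α β, IsStructureFn (F.par t α + F.par (t + 1) β) (Z t α β))
    (hs : IsKoszulTate S₀ hU Z r s)
    {B : Fin (F.mult 0) → Fin (F.mult r) → Alg U}
    (hB : ∀ i α, IsStructureFn (F.par 0 i + F.par r α + F.par (r + 2) γ) (B i α))
    (hNoether : ∀ α, ∑ β, Z r α β * Z (r + 1) β γ = ∑ i, S₀.eom hU i * B i α) :
    ∃ n : Alg U, n ∈ afnPart F (Smooth F U) (r + 2) ∧
      n ∈ parityPart F (Smooth F U) (F.par (r + 2) γ + r) ∧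
      hs.der n ∈ cpx F (Smooth F U) ((r : ℤ) - 2) ∧
      n - ∑ β, Φs U (r + 1) β * Z (r + 1) β γ ∈ orderAf F (Smooth F U) 2 := by
  have hZr := hZ (r + 1) le_rfl
  refine ⟨∑ β, Φs U (r + 1) β * Z (r + 1) β γ -
    ∑ α, sgn (Gen.af r α).parity • (Φs U r α * ∑ i, Φs U 0 i * B i α),
    Submodule.sub_mem _ (Submodule.sum_mem _ fun β _ => ?_) (Submodule.sum_mem _ fun α _ =>
      zsmul_mem_wordSpan _ (afn_bilinear_mem α fun i => (hB i α).1)),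
    Submodule.sub_mem _ (Submodule.sum_mem _ fun β _ => parity_linear_mem β (hZr β γ))
      (Submodule.sum_mem _ fun α _ => zsmul_mem_wordSpan _ (parity_bilinear_mem α fun i => hB i α)),
    ?_, ?_⟩
  · convert afn_linear_mem β (hZr β γ).1 using 2
    push_cast
    ring
  · rw [map_sub, hs.der_linear (fun β => (hZr β γ).1) hNoether,
      hs.der_bilinear fun i α => (hB i α).1, add_sub_add_right_eq_sub]
    -- After the cancellation two kinds of terms remain: the quadratic remainders of `D c*_{α_r}`,
    -- of antifield number `r + 1`, and `D c*_{α_{r-1}}`, of antifield number `r`, times `φ*`.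
    -- Neither reaches beyond stage `r - 2`.
    refine Subalgebra.sub_mem _ (Subalgebra.sum_mem _ fun β _ => Subalgebra.mul_mem _ ?_
      (mem_cpx_of_mem_phiPart (hZr β γ).1)) (Subalgebra.sum_mem _ fun α _ =>
        Subalgebra.zsmul_mem _ (Subalgebra.mul_mem _ ?_ (Subalgebra.sum_mem _ fun i _ =>
          Subalgebra.mul_mem _ (gen_mem_cpx ?_) (mem_cpx_of_mem_phiPart (hB i α).1))) _)
    · refine mem_cpx_of_mem_orderAf_two (hs.value_higherStage le_rfl hr β)
        (Submodule.sub_mem _ ?_ (Submodule.sum_mem _ fun α _ =>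
          afn_linear_mem α (hZ r (by omega) α β).1))
      convert hs.value_mem_afnPart (.af (r + 1) β) using 2
      simp only [Gen.afn]
      push_cast
      ring
    · refine mem_cpx_of_mem_afnPart (j := r) (by omega) ?_
      convert hs.value_mem_afnPart (.af r α) using 2
      simp only [Gen.afn]
      ring
    · simp only [Gen.InCpx]
      omega
  · rw [sub_sub_cancel_left]
    refine Submodule.neg_mem _ (Submodule.sum_mem _ fun α _ => zsmul_mem_wordSpan _ ?_)
    exact mul_mem_orderAf (n := 1) (gen_af_mem_orderAf r α) (Submodule.sum_mem _ fun i _ =>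
      mul_mem_orderAf (n := 0) (gen_af_mem_orderAf 0 i) (mem_orderAf_zero _))

/-- The value of the extended operator on a new antifield. -/
theorem IsKoszulTate.exists_closed (hr : 1 ≤ r)
    (hZ : ∀ t ≤ r + 1, ∀ α β, IsStructureFn (F.par t α + F.par (t + 1) β) (Z t α β))
    (hs : IsKoszulTate S₀ hU Z r s) (hnil : IsNilpotentOp s)
    (hacyc : IsAcyclicOn s ((r : ℤ) - 2))
    {B : Fin (F.mult 0) → Fin (F.mult r) → Alg U}
    (hB : ∀ i α, IsStructureFn (F.par 0 i + F.par r α + F.par (r + 2) γ) (B i α))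
    (hNoether : ∀ α, ∑ β, Z r α β * Z (r + 1) β γ = ∑ i, S₀.eom hU i * B i α) :
    ∃ n : Alg U, n ∈ afnPart F (Smooth F U) (r + 2) ∧
      n ∈ parityPart F (Smooth F U) (F.par (r + 2) γ + r) ∧ n ∈ cpx F (Smooth F U) r ∧
      hs.der n = 0 ∧ n - ∑ β, Φs U (r + 1) β * Z (r + 1) β γ ∈ orderAf F (Smooth F U) 2 := by
  obtain ⟨p, hp, hp', hpc, hp2⟩ := hs.exists_approx hr hZ hB hNoether
  have hf : hs.der p ∈ afnPart F (Smooth F U) ((r : ℤ) + 2 - 1) :=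
    superDer_mem_afnPart hs.value_mem_afnPart hp
  have hf' : hs.der p ∈ parityPart F (Smooth F U) (F.par (r + 2) γ + r + 1) :=
    superDer_mem_parityPart hp'
  -- `D p` is closed by nilpotency and has antifield number `r + 1 > 0`, so acyclicity applies.
  obtain ⟨g, hg, hDg⟩ := hs.exists_der_eq (by omega) hacyc (by omega) hf hpc
    (hs.der_der hnil (mem_cpx_of_mem_afnPart (fun _ => le_rfl) hp))
  have hDg' := superDer_proj (hv := hs.value_mem_parityPart) (f := Gen.bidegree) (m := (-1, 1))
    (w := ((r : ℤ) + 2, F.par (r + 2) γ + r))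
    (fun x => mem_bidegree_iff.2 ⟨hs.value_mem_afnPart x, hs.value_mem_parityPart x⟩)
    (mem_bidegree_iff.2 ⟨hf, hf'⟩) hDg
  have hg' := proj_mem (permInvariant_sum (Gen.bidegree (F := F))
    (fun n => n = ((r : ℤ) + 2, F.par (r + 2) γ + r))) (mem_cpx_iff.1 hg)
  obtain ⟨hg1, hg2⟩ := mem_bidegree_iff.1 (wordSpan_mono (fun _ h => h.2) hg')
  have hgc := mem_cpx_iff.2 (wordSpan_mono (fun _ h => h.1) hg')
  generalize proj (fun l => (l.map Gen.bidegree).sum = ((r : ℤ) + 2, F.par (r + 2) γ + r)) g = g'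
    at hDg' hg1 hg2 hgc
  -- The correction contains no `c*_{α_r}`, so it cannot disturb the leading term.
  have hg3 := mem_orderAf_two_of_mem_cpx
    (cpx_mono (show (r : ℤ) - 2 + 1 ≤ r - 1 by omega) hgc) hg1
  refine ⟨p - g', Submodule.sub_mem _ hp hg1, Submodule.sub_mem _ hp' hg2,
    mem_cpx_of_mem_afnPart (fun _ => le_rfl) (Submodule.sub_mem _ hp hg1), ?_, ?_⟩
  · rw [map_sub, sub_eq_zero]
    exact hDg'.symm
  · rw [sub_right_comm]
    exact Submodule.sub_mem _ hp2 hg3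

end

/-- The values of an operator on the generators, extended to the antifields of a new stage. -/
def extendValue (v : Gen F → Alg U) (u : ℕ) (n : Fin (F.mult u) → Alg U) : Gen F → Alg U
  | .theta i => v (.theta i)
  | .af t α => if h : t = u then n (h ▸ α) else v (.af t α)

theorem extendValue_of_inCpx {v : Gen F → Alg U} {u : ℕ} {n : Fin (F.mult u) → Alg U} {x : Gen F}
    {k : ℤ} (hx : x.InCpx k) (hk : k < (u : ℤ) - 1) : extendValue v u n x = v x := by
  cases x with
  | theta i => rfl
  | af t α =>
    simp only [Gen.InCpx] at hx
    exact dif_neg (by omega)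

@[simp] theorem extendValue_af {v : Gen F → Alg U} {u : ℕ} {n : Fin (F.mult u) → Alg U}
    (α : Fin (F.mult u)) : extendValue v u n (.af u α) = n α := dif_pos rfl

theorem extendValue_mem {v : Gen F → Alg U} {u : ℕ} {n : Fin (F.mult u) → Alg U}
    {S : Gen F → Submodule (Smooth F U) (Alg U)} (hv : ∀ x, v x ∈ S x)
    (hn : ∀ α, n α ∈ S (.af u α)) (x : Gen F) : extendValue v u n x ∈ S x := by
  cases x with
  | theta i => exact hv _
  | af t α =>
    by_cases h : t = u
    · subst h
      rw [extendValue_af]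
      exact hn α
    · rw [show extendValue v u n (.af t α) = v (.af t α) from dif_neg h]
      exact hv (.af t α)

/-- A superderivation that preserves the `k`th complex, as an operator on it. -/
noncomputable def restrictOp {k : ℤ} (D : Alg U →ₗ[Smooth F U] Alg U)
    (hD : ∀ a ∈ cpx F (Smooth F U) k, D a ∈ cpx F (Smooth F U) k) : Op U k where
  toFun a := ⟨D a, hD a a.2⟩
  map_add' a b := Subtype.ext (map_add D (a : Alg U) b)
  map_smul' c a := Subtype.ext (map_smul D c (a : Alg U))

/-- Extension of a Koszul-Tate operator to the antifields of the next stage. -/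
theorem IsKoszulTate.exists_extension {r : ℕ} {s : Op U (r : ℤ)}
    (hs : IsKoszulTate S₀ hU Z r s) (hnil : IsNilpotentOp s) {n : Fin (F.mult (r + 2)) → Alg U}
    (hn : ∀ γ, n γ ∈ afnPart F (Smooth F U) (r + 2) ∧
      n γ ∈ parityPart F (Smooth F U) (F.par (r + 2) γ + r) ∧ n γ ∈ cpx F (Smooth F U) r ∧
      hs.der (n γ) = 0 ∧
      n γ - ∑ β, Φs U (r + 1) β * Z (r + 1) β γ ∈ orderAf F (Smooth F U) 2) :
    ∃ s' : Op U ((r : ℤ) + 1), IsKoszulTate S₀ hU Z (r + 1) s' ∧ IsNilpotentOp s' ∧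
      Extends (le_refl U) s s' ∧
      ∀ (h : ((r + 2 : ℕ) : ℤ) - 1 ≤ (r : ℤ) + 1) (γ : Fin (F.mult (r + 2))),
        (s' (afIn h γ) : Alg U) = n γ := by
  let v := extendValue s.value (r + 2) n
  have hlt : (r : ℤ) < ((r + 2 : ℕ) : ℤ) - 1 := by push_cast; omega
  have hvs : ∀ x : Gen F, x.InCpx r → s.value x = v x := fun x hx =>
    (extendValue_of_inCpx hx hlt).symm
  have hvn : ∀ γ, v (.af (r + 2) γ) = n γ := fun γ => extendValue_af γ
  have hv : ∀ x : Gen F, v x ∈ parityPart F (Smooth F U) (x.parity + 1) :=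
    extendValue_mem hs.value_mem_parityPart fun γ => by
      convert (hn γ).2.1 using 2
      simp only [Gen.parity]
      push_cast
      linear_combination 2 * CharTwo.add_self_eq_zero (1 : ZMod 2)
  have hva : ∀ x : Gen F, v x ∈ afnPart F (Smooth F U) (x.afn - 1) :=
    extendValue_mem hs.value_mem_afnPart fun γ => by
      convert (hn γ).1 using 2
      simp only [Gen.afn]
      push_cast
      ring
  -- No value involves the new antifields, so a second application of the operator only uses the old
  -- one.
  have hvc : ∀ x : Gen F, v x ∈ cpx F (Smooth F U) r :=
    extendValue_mem (S := fun _ => (cpx F (Smooth F U) r).toSubmodule)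
      (fun _ => IsKoszulTate.value_mem_cpx _) fun γ => (hn γ).2.2.1
  have hcongr : ∀ a ∈ cpx F (Smooth F U) r, hs.der a = superDer 1 v hv a := fun a ha =>
    superDer_congr hvs (mem_cpx_iff.1 ha)
  let s' : Op U ((r : ℤ) + 1) := restrictOp (superDer 1 v hv) fun a ha =>
    superDer_mem_cpx (fun x _ => cpx_mono (by omega) (hvc x)) ha
  have hs' : ∀ a, (s' a : Alg U) = superDer 1 v hv a := fun _ => rfl
  have hgen : ∀ {t : ℕ} (h : (t : ℤ) - 1 ≤ (r : ℤ) + 1) (α : Fin (F.mult t)),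
      (s' (afIn h α) : Alg U) = v (.af t α) := fun h α => superDer_gen 1 v hv _
  refine ⟨s', ⟨fun e a b ha => ?_, fun e a ha => superDer_mem_parityPart ha,
    fun j a ha => superDer_mem_afnPart hva ha, fun i => ?_, fun hk i => ?_, fun hk α => ?_,
    fun t hk α ht => ?_⟩, fun a => ?_, fun a b hb => ?_, fun h γ => ?_⟩
  · refine Subtype.ext ?_
    refine (superDer_mul_of_mem 1 v hv ha b).trans ?_
    rw [one_mul]
    rfl
  · refine Subtype.ext ((superDer_gen 1 v hv _).trans ?_)
    exact hs.value_theta i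
  · rw [hgen, ← hvs (.af 0 i) (by simp only [Gen.InCpx]; omega)]
    exact hs.value_original (by omega) i
  · rw [hgen, ← hvs (.af 1 α) (by simp only [Gen.InCpx]; omega)]
    exact hs.value_stageZero (by omega) α
  · rw [hgen]
    by_cases h : t = r + 1
    · subst h
      rw [hvn]
      exact (hn α).2.2.2.2
    · have hk' : (t : ℤ) ≤ r := by push_cast at hk; omega
      rw [← hvs (.af (t + 1) α) (by simp only [Gen.InCpx]; omega)]
      exact hs.value_higherStage hk' ht α
  · refine Subtype.ext ?_
    rw [hs', hs']
    refine superDer_superDer_eq_zero (P := fun x => x.InCpx ((r : ℤ) + 1)) (fun x hx => ?_)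
      (mem_cpx_iff.1 a.2)
    -- On old generators nilpotency is inherited; on the new ones it is the closedness of `n`.
    rw [← hcongr _ (hvc x)]
    by_cases hx' : x.InCpx r
    · rw [← hvs x hx']
      have := hs.der_der hnil (gen_mem_cpx hx')
      rwa [IsKoszulTate.der, superDer_gen] at this
    · cases x with
      | theta i => exact absurd trivial hx'
      | af t γ =>
        simp only [Gen.InCpx] at hx hx'
        obtain rfl : t = r + 2 := by omega
        rw [hvn]
        exact (hn γ).2.2.2.1
  · rw [Alg.res_refl] at hb ⊢
    rw [hs', hb, hs.coe_apply, hcongr _ a.2]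
  · rw [hgen, hvn]

end Existence

end KoszulTate

namespace KoszulTate

variable {F : FieldContent}

/-! ### General form of an extension -/

section Uniqueness

variable {Ω U : Opens (Base F)} {S₀ : SuperFn Ω} {hU : U ≤ Ω} {Z : Generators U}

theorem countP_isGhostAntifield_le (l : List (Gen F)) :
    l.countP Gen.isGhostAntifield ≤ l.countP Gen.isAntifield :=
  List.countP_mono_left fun x _ h => by
    cases x with
    | theta i => simp [Gen.isGhostAntifield] at h
    | af t α => rfl

/-- A Koszul-Tate operator maps `𝒪((c*)^2, (Φ*)^3)` to `𝒪((Φ*)^2)`. -/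
theorem IsKoszulTate.der_mem_orderAf_two {k : ℤ} {s : Op U k} (hs : IsKoszulTate S₀ hU Z k s)
    {a : Alg U} (ha : a ∈ orderMixed F (Smooth F U)) : hs.der a ∈ orderAf F (Smooth F U) 2 := by
  refine superDer_mem 1 s.value hs.value_mem_parityPart (fun l₁ x l₂ hl => ?_) ha
  have h₁ : word F (Smooth F U) l₁ ∈ wordSpan F (Smooth F U) fun l => l = l₁ :=
    word_mem_wordSpan rfl
  have h₂ : word F (Smooth F U) l₂ ∈ wordSpan F (Smooth F U) fun l => l = l₂ :=
    word_mem_wordSpan rfl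
  have g₁ := countP_isGhostAntifield_le l₁
  have g₂ := countP_isGhostAntifield_le l₂
  have key : ∀ (m : ℕ) {b : Alg U}, b ∈ orderAf F (Smooth F U) m →
      2 ≤ m + l₁.countP Gen.isAntifield + l₂.countP Gen.isAntifield →
      word F (Smooth F U) l₁ * b * word F (Smooth F U) l₂ ∈ orderAf F (Smooth F U) 2 :=
    fun m b hb hm => mul_mem_wordSpan
      (P := fun l => m + l₁.countP Gen.isAntifield ≤ l.countP Gen.isAntifield)
      (by
        rintro l _ h rfl
        rw [List.countP_append]
        omega)
      (mul_mem_wordSpan (by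
        rintro _ l rfl h
        rw [List.countP_append]
        omega) h₁ hb) h₂
  match x with
  | .theta i =>
    rw [hs.value_theta, mul_zero, zero_mul]
    exact Submodule.zero_mem _
  -- Replacing a `φ*` by a function leaves either two `c*` or two other antifields.
  | .af 0 i =>
    refine key 0 (mem_orderAf_zero _) ?_
    simp [List.countP_cons, Gen.isGhostAntifield, Gen.isAntifield] at hl
    omega
  -- The image of a `c*` has positive antifield number, so it supplies one antifield itself; at
  -- least one more remains.
  | .af (t + 1) α =>
    refine key 1 (mem_orderAf_one ?_ (hs.value_mem_afnPart (.af (t + 1) α))) ?_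
    · simp only [Gen.afn]
      push_cast
      omega
    · simp [List.countP_cons, Gen.isGhostAntifield, Gen.isAntifield] at hl
      omega

/-- The terms with two antifields of antifield number `r + 2`. -/
theorem exists_bilinear_normalForm {r : ℕ} (hr : 1 ≤ r) {γ : Fin (F.mult (r + 2))} {M : Alg U}
    (h2 : M ∈ orderAf F (Smooth F U) 2) (hafn : M ∈ afnPart F (Smooth F U) (r + 2))
    (hpar : M ∈ parityPart F (Smooth F U) (F.par (r + 2) γ + r)) :
    ∃ N : Fin (F.mult r) → Fin (F.mult 0) → Alg U,
      (∀ α i, IsStructureFn (F.par 0 i + F.par r α + F.par (r + 2) γ) (N α i)) ∧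
      M - ∑ α, Φs U r α * ∑ i, Φs U 0 i * N α i ∈ orderMixed F (Smooth F U) := by
  let m : Fin (F.mult r) × Fin (F.mult 0) → List (Gen F) := fun q => [.af r q.1, .af 0 q.2]
  have hP : ∀ l : List (Gen F), (2 ≤ l.countP Gen.isAntifield ∧ (l.map Gen.afn).sum = r + 2) ∧
      (l.map Gen.parity).sum = F.par (r + 2) γ + r →
      (l.map Gen.parity).sum = F.par (r + 2) γ + r ∧
        (word F (Smooth F U) l ∈ orderMixed F (Smooth F U) ∨
        ∃ q l', l'.countP Gen.isAntifield = 0 ∧ l.Perm (m q ++ l')) := by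
    rintro l ⟨⟨hl2, hl⟩, hl'⟩
    refine ⟨hl', ?_⟩
    obtain ⟨a, l', h, hp⟩ := exists_perm_antifields_append l
    rw [(hp.map _).sum_eq, List.map_append, List.sum_append, sum_afn_eq_zero h, add_zero] at hl
    by_cases hm : 2 ≤ l.countP Gen.isGhostAntifield ∨ 3 ≤ l.countP Gen.isAntifield
    · exact Or.inl (word_mem_wordSpan hm)
    · refine Or.inr ?_
      rw [hp.countP_eq, hp.countP_eq, List.countP_append, List.countP_append, h] at hm
      rw [hp.countP_eq, List.countP_append, h] at hl2
      -- Exactly two antifields remain, at most one of them a `c*`. Two `φ*` would have antifield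
      -- number `2 < r + 2`, so the pair consists of `c*_{α_{r-1}}` and `φ*`.
      match a with
      | [] => simp at hl2
      | [⟨t, α⟩] => simp [Gen.isAntifield] at hl2
      | [⟨0, α⟩, ⟨0, β⟩] =>
        simp [Gen.afn] at hl
        omega
      | [⟨0, α⟩, ⟨u + 1, β⟩] =>
        obtain rfl : u + 1 = r := by simp [Gen.afn] at hl; omega
        exact ⟨(β, α), l', h, hp.trans (List.Perm.swap _ _ _)⟩
      | [⟨t + 1, α⟩, ⟨0, β⟩] =>
        obtain rfl : t + 1 = r := by simp [Gen.afn] at hl; omega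
        exact ⟨(α, β), l', h, hp⟩
      | [⟨t + 1, α⟩, ⟨u + 1, β⟩] =>
        refine absurd (Or.inl ?_) hm
        simp only [List.map_cons, List.countP_cons, Gen.isGhostAntifield, if_true]
        omega
      | ⟨t, α⟩ :: ⟨u, β⟩ :: ⟨w, δ⟩ :: a =>
        refine absurd (Or.inr ?_) hm
        simp only [List.map_cons, List.countP_cons, Gen.isAntifield, if_true]
        omega
  obtain ⟨N, hN, h⟩ := exists_normalForm m _ (orderMixed F (Smooth F U)) hP
    (mem_wordSpan_and (permInvariant_sum _ (fun n => n = F.par (r + 2) γ + r))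
      (mem_wordSpan_and (permInvariant_sum _ (fun n => n = (r : ℤ) + 2)) h2 hafn) hpar)
  refine ⟨fun α i => N (α, i), fun α i => ⟨(hN _).1, ?_⟩, ?_⟩
  · convert (hN (α, i)).2 using 2
    simp only [m, List.map_cons, List.map_nil, List.sum_cons, List.sum_nil, Gen.parity]
    push_cast
    linear_combination -CharTwo.add_self_eq_zero (r : ZMod 2) -
      CharTwo.add_self_eq_zero (1 : ZMod 2)
  · rw [Fintype.sum_prod_type] at h
    simpa [m, Finset.mul_sum, mul_assoc] using h

theorem sum_mul_zsmul {ι : Type*} [Fintype ι] (n : ℤ) (a b : ι → Alg U) :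
    ∑ i, a i * (n • b i) = n • ∑ i, a i * b i := by
  simp only [mul_smul_comm]
  exact (map_sum (zsmulAddGroupHom (α := Alg U) n) _ _).symm

/-- The general form of an extension to the next stage. -/
theorem IsKoszulTate.exists_normalForm {r : ℕ} (hr : 1 ≤ r)
    (hZ : ∀ t ≤ r + 1, ∀ α β, IsStructureFn (F.par t α + F.par (t + 1) β) (Z t α β))
    {s : Op U ((r : ℤ) + 1)} (hs : IsKoszulTate S₀ hU Z (r + 1) s) (hnil : IsNilpotentOp s)
    (hex : KoszulExact (S₀.eom hU) (Z 0))
    {γ : Fin (F.mult (r + 2))} {B : Fin (F.mult 0) → Fin (F.mult r) → Alg U}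
    (hB : ∀ i α, IsStructureFn (F.par 0 i + F.par r α + F.par (r + 2) γ) (B i α))
    (hNoether : ∀ α, ∑ β, Z r α β * Z (r + 1) β γ = ∑ i, S₀.eom hU i * B i α) :
    ∃ (X : Fin (F.mult r) → Fin (F.mult 1) → Alg U)
      (Y : Fin (F.mult r) → Fin (F.mult 0) → Fin (F.mult 0) → Alg U),
      (∀ α a, IsStructureFn (F.par 1 a + F.par r α + F.par (r + 2) γ) (X α a)) ∧
      (∀ α j i, IsStructureFn (F.par 0 j + F.par 0 i + F.par r α + F.par (r + 2) γ) (Y α j i)) ∧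
      (∀ α j i, Y α j i = -(sgn (F.par 0 i * F.par 0 j) • Y α i j)) ∧
      s.value (.af (r + 2) γ) - (∑ β, Φs U (r + 1) β * Z (r + 1) β γ -
        ∑ α, sgn (Gen.af r α).parity • (Φs U r α * ∑ i, Φs U 0 i *
          (B i α + ∑ a, Z 0 i a * X α a + ∑ j, S₀.eom hU j * Y α j i))) ∈
        orderMixed F (Smooth F U) := by
  have hZr := hZ (r + 1) le_rfl
  have hT : ∀ i, S₀.eom hU i ∈ phiPart F (Smooth F U) := fun i => SuperFn.toAlg_mem_phiPart _ _
  set n := s.value (.af (r + 2) γ) with hn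
  have hn2 := hs.value_higherStage (t := r + 1) (by push_cast; rfl) (by omega) γ
  obtain ⟨N, hN, hM⟩ := exists_bilinear_normalForm hr hn2
    (Submodule.sub_mem _ (by
      convert hs.value_mem_afnPart (.af (r + 2) γ) using 2
      simp only [Gen.afn]
      push_cast
      ring) (Submodule.sum_mem _ fun β _ => by
        convert afn_linear_mem β (hZr β γ).1 using 2
        push_cast
        ring))
    (Submodule.sub_mem _ (by
      convert hs.value_mem_parityPart (.af (r + 2) γ) using 2
      simp only [Gen.parity]
      push_cast
      linear_combination -2 * CharTwo.add_self_eq_zero (1 : ZMod 2))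
      (Submodule.sum_mem _ fun β _ => parity_linear_mem β (hZr β γ)))
  rw [← hn] at hM
  have hDn : hs.der n = 0 := by
    have hc : (Gen.af (r + 2) γ : Gen F).InCpx ((r : ℤ) + 1) := by
      simp only [Gen.InCpx]
      push_cast
      omega
    have := hs.der_der hnil (gen_mem_cpx hc)
    rwa [IsKoszulTate.der, superDer_gen] at this
  -- Modulo two antifields only the Noether identity contributes to the image of the leading term.
  have hlin : hs.der (∑ β, Φs U (r + 1) β * Z (r + 1) β γ) -
      ∑ α, Φs U r α * ∑ i, S₀.eom hU i * B i α ∈ orderAf F (Smooth F U) 2 := by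
    have h1 : hs.der (∑ β, Φs U (r + 1) β * Z (r + 1) β γ) =
        ∑ β, s.value (.af (r + 1) β) * Z (r + 1) β γ := by
      rw [map_sum]
      exact Finset.sum_congr rfl fun β _ =>
        superDer_gen_mul_of_mem_phiPart hs.value_theta _ (hZr β γ).1
    have h2 : ∑ α, Φs U r α * ∑ i, S₀.eom hU i * B i α =
        ∑ β, (∑ α, Φs U r α * Z r α β) * Z (r + 1) β γ := by
      simp only [← hNoether, Finset.sum_mul, Finset.mul_sum, mul_assoc]
      exact Finset.sum_comm
    rw [h1, h2, ← Finset.sum_sub_distrib]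
    refine Submodule.sum_mem _ fun β _ => ?_
    rw [← sub_mul]
    exact mul_mem_orderAf (n := 0) (hs.value_higherStage (by omega) hr β) (mem_orderAf_zero _)
  have hbil : hs.der (∑ α, Φs U r α * ∑ i, Φs U 0 i * N α i) -
      ∑ α, Φs U r α * (sgn (Gen.af r α).parity • ∑ i, S₀.eom hU i * N α i) ∈
        orderAf F (Smooth F U) 2 := by
    rw [map_sum, ← Finset.sum_sub_distrib]
    refine Submodule.sum_mem _ fun α _ => ?_
    rw [IsKoszulTate.der, superDer_bilinear hs.value_theta α fun i => (hN α i).1, mul_smul_comm]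
    simp only [hs.value_original (show (-1 : ℤ) ≤ r + 1 by omega)]
    rw [add_sub_cancel_right]
    -- `D c*_{α_{r-1}}` has antifield number `r ≥ 1`, so multiplied by `φ*` it is at least quadratic
    -- and drops out.
    refine mul_mem_orderAf (n := 1) (mem_orderAf_one (j := (Gen.af r α).afn - 1) ?_
      (hs.value_mem_afnPart _)) (Submodule.sum_mem _ fun i _ =>
        mul_mem_orderAf (n := 0) (gen_af_mem_orderAf 0 i) (mem_orderAf_zero _))
    simp only [Gen.afn]
    omega
  have hmix := hs.der_mem_orderAf_two hM
  have hsum : ∑ α, Φs U r α * (∑ i, S₀.eom hU i * B i α +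
      sgn (Gen.af r α).parity • ∑ i, S₀.eom hU i * N α i) ∈ orderAf F (Smooth F U) 2 := by
    rw [map_sub, map_sub, hDn] at hmix
    have h := Submodule.neg_mem _ (Submodule.add_mem _ (Submodule.add_mem _ hlin hbil) hmix)
    convert h using 1
    simp only [mul_add, Finset.sum_add_distrib]
    abel
  -- Linear independence of the `c*_{α_{r-1}}` modulo two antifields gives one relation for each
  -- `α`.
  have hzero : ∀ α, ∑ i, S₀.eom hU i * B i α +
      sgn (Gen.af r α).parity • ∑ i, S₀.eom hU i * N α i = 0 :=
    eq_zero_of_sum_mul_mem_orderAf (fun α => Submodule.add_mem _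
      (Submodule.sum_mem _ fun i _ => mul_mem_phiPart (hT i) (hB i α).1)
      (zsmul_mem_wordSpan _ (Submodule.sum_mem _ fun i _ =>
        mul_mem_phiPart (hT i) (hN α i).1))) hsum
  -- The deviation of `∓N` from `B` is a syzygy of the field equations, to be resolved by `hex`.
  have hE : ∀ α, ∑ i, S₀.eom hU i * (-sgn (Gen.af r α).parity • N α i - B i α) = 0 := fun α => by
    simp only [mul_sub, Finset.sum_sub_distrib]
    rw [sum_mul_zsmul, neg_zsmul, eq_neg_of_add_eq_zero_left (hzero α), sub_self]
  choose X Y hX hY hYanti hXY using fun α => hex (F.par r α + F.par (r + 2) γ) _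
    (fun i => ⟨Submodule.sub_mem _ (zsmul_mem_wordSpan _ (hN α i).1) (hB i α).1,
      Submodule.sub_mem _ (zsmul_mem_wordSpan _ (by rw [← add_assoc]; exact (hN α i).2))
        (by rw [← add_assoc]; exact (hB i α).2)⟩) (hE α)
  refine ⟨X, Y, fun α a => ⟨(hX α a).1, by rw [add_assoc]; exact (hX α a).2⟩,
    fun α j i => ⟨(hY α j i).1, by rw [add_assoc (_ + _)]; exact (hY α j i).2⟩, hYanti, ?_⟩
  have hfin : ∀ α, sgn (Gen.af r α).parity • (Φs U r α * ∑ i, Φs U 0 i *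
      (B i α + ∑ a, Z 0 i a * X α a + ∑ j, S₀.eom hU j * Y α j i)) =
      -(Φs U r α * ∑ i, Φs U 0 i * N α i) := fun α => by
    have h1 : ∀ i, B i α + ∑ a, Z 0 i a * X α a + ∑ j, S₀.eom hU j * Y α j i =
        -sgn (Gen.af r α).parity • N α i := fun i => by
      rw [add_assoc, ← hXY α i, add_sub_cancel]
    simp only [h1]
    rw [sum_mul_zsmul, mul_smul_comm, smul_smul, mul_neg, sgn_mul_self, neg_one_zsmul]
  simp only [hfin, Finset.sum_neg_distrib]
  rw [sub_neg_eq_add, ← sub_sub]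
  exact hM

end Uniqueness

end KoszulTate
-- The lemma on the next stage of the Koszul–Tate operator
theorem mainTheorem9 (F : KoszulTate.FieldContent)
    (Ω : Opens (KoszulTate.Base F)) (S₀ : KoszulTate.SuperFn Ω) (hS₀ : S₀.IsEven)
    (U : Opens (KoszulTate.Base F)) (hU : U ≤ Ω)
    (hnear : S₀.stationarySurface ⊆ (U : Set (KoszulTate.Base F)))
    (r : ℕ) (hr : 1 ≤ r)
    (Z : KoszulTate.Generators U)
    (hZ : ∀ t ≤ r + 1, ∀ α β,
      KoszulTate.IsStructureFn (F.par t α + F.par (t + 1) β) (Z t α β))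
    (s : KoszulTate.Op U (r : ℤ))
    (hs : KoszulTate.IsKoszulTate S₀ hU Z r s)
    (hnil : KoszulTate.IsNilpotentOp s)
    (hacyc : KoszulTate.IsAcyclicOn s ((r : ℤ) - 2))
    (B : Fin (F.mult 0) → Fin (F.mult r) → Fin (F.mult (r + 2)) → KoszulTate.Alg U)
    (hB : ∀ i α γ,
      KoszulTate.IsStructureFn (F.par 0 i + F.par r α + F.par (r + 2) γ) (B i α γ))
    (hNoether : ∀ α γ, ∑ β, Z r α β * Z (r + 1) β γ = ∑ i, S₀.eom hU i * B i α γ) :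
    (∃ s' : KoszulTate.Op U ((r : ℤ) + 1),
      KoszulTate.IsKoszulTate S₀ hU Z (r + 1) s' ∧
      KoszulTate.IsNilpotentOp s' ∧
      KoszulTate.Extends (le_refl U) s s' ∧
      ∀ (h : ((r + 2 : ℕ) : ℤ) - 1 ≤ (r : ℤ) + 1) (γ : Fin (F.mult (r + 2))),
        (s' (KoszulTate.afIn h γ) : KoszulTate.Alg U) -
            ∑ β, KoszulTate.Φs U (r + 1) β * Z (r + 1) β γ
          ∈ KoszulTate.orderAf F (KoszulTate.Smooth F U) 2) ∧
    (∀ (V : Opens (KoszulTate.Base F)) (hV : V ≤ U),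
      S₀.stationarySurface ⊆ (V : Set (KoszulTate.Base F)) →
      ∀ s' : KoszulTate.Op V ((r : ℤ) + 1),
        KoszulTate.IsKoszulTate S₀ (hV.trans hU)
          (fun t α β => KoszulTate.Alg.res hV (Z t α β)) (r + 1) s' →
        KoszulTate.IsNilpotentOp s' →
        KoszulTate.Extends hV s s' →
        ∃ (X : Fin (F.mult 1) → Fin (F.mult r) → Fin (F.mult (r + 2)) → KoszulTate.Alg V)
          (Y : Fin (F.mult 0) → Fin (F.mult 0) → Fin (F.mult r) → Fin (F.mult (r + 2)) →
            KoszulTate.Alg V),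
          (∀ a α γ,
            KoszulTate.IsStructureFn (F.par 1 a + F.par r α + F.par (r + 2) γ) (X a α γ)) ∧
          (∀ j i α γ,
            KoszulTate.IsStructureFn (F.par 0 j + F.par 0 i + F.par r α + F.par (r + 2) γ)
              (Y j i α γ)) ∧
          (∀ j i α γ, Y j i α γ = -(KoszulTate.sgn (F.par 0 i * F.par 0 j) • Y i j α γ)) ∧
          ∀ (h : ((r + 2 : ℕ) : ℤ) - 1 ≤ (r : ℤ) + 1) (γ : Fin (F.mult (r + 2))),
            (s' (KoszulTate.afIn h γ) : KoszulTate.Alg V) -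
                (∑ β, KoszulTate.Φs V (r + 1) β * KoszulTate.Alg.res hV (Z (r + 1) β γ) -
                  ∑ α, KoszulTate.sgn (KoszulTate.Gen.af r α).parity •
                    (KoszulTate.Φs V r α * ∑ i, KoszulTate.Φs V 0 i *
                      (KoszulTate.Alg.res hV (B i α γ) +
                        ∑ a, KoszulTate.Alg.res hV (Z 0 i a) * X a α γ +
                        ∑ j, S₀.eom (hV.trans hU) j * Y j i α γ)))
              ∈ KoszulTate.orderMixed F (KoszulTate.Smooth F V)) := by
  have hres : ∀ {V : Opens (KoszulTate.Base F)} (hV : V ≤ U) {e : ZMod 2} {f : KoszulTate.Alg U},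
      KoszulTate.IsStructureFn e f → KoszulTate.IsStructureFn e (KoszulTate.Alg.res hV f) :=
    fun hV _ _ hf => ⟨KoszulTate.SAlg.map_mem _ hf.1, KoszulTate.SAlg.map_mem _ hf.2⟩
  constructor
  · choose n hn using fun γ => hs.exists_closed hr hZ hnil hacyc (γ := γ) (fun i α => hB i α γ)
      fun α => hNoether α γ
    obtain ⟨s', hs', hnil', hext, hval⟩ := hs.exists_extension hnil hn
    exact ⟨s', hs', hnil', hext, fun h γ => by rw [hval]; exact (hn γ).2.2.2.2⟩
  · intro V hV hS s' hs' hnil' _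
    -- Exactness comes from the acyclic operator over `U`, with `r - 2 ≥ -1`, and is then localised
    -- to `V`.
    have hex := (hs.koszulExact (j := (r : ℤ) - 2) (by omega) (by omega) (by omega) hacyc
      fun i a => (hZ 0 (by omega) i a).1).res hS₀ hU hV hS (hs.eom_mem_parityPart (by omega))
    choose X Y hX hY hYanti hXY using fun γ => hs'.exists_normalForm hr
      (fun t ht α β => hres hV (hZ t ht α β)) hnil' hex (γ := γ)
      (B := fun i α => KoszulTate.Alg.res hV (B i α γ)) (fun i α => hres hV (hB i α γ))
      (fun α => by
        simp only [← map_mul, ← map_sum, hNoether]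
        simp only [map_mul, map_sum, KoszulTate.Alg.res_eom])
    refine ⟨fun a α γ => X γ α a, fun j i α γ => Y γ α j i, fun a α γ => hX γ α a,
      fun j i α γ => hY γ α j i, fun j i α γ => hYanti γ α j i, fun h γ => ?_⟩
    have := hXY γ
    rw [KoszulTate.Op.value_of_inCpx (x := .af (r + 2) γ) h] at this
    exact this
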